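/- Let $k$ be a field and let $H$ be a Hopf algebra over $k$ with bijective antipode $S$, comultiplication $\Delta(h)=h_1\otimes h_2$, counit $\epsilon$ and centre $Z(H)$. Let $R=R^{(1)}\otimes R^{(2)}\in H\otimes H$ (summation understood; $R'$ denotes a second copy of $R$) be an invertible element such that $(H,R)$ is semiquasitriangular, that is: 1. $R^{(1)}_1\otimes R^{(1)}_2\otimes R^{(2)}=R^{(1)}\otimes R'^{(1)}\otimes R^{(2)}R'^{(2)}$; 2. $R^{(1)}\otimes R^{(2)}_1\otimes R^{(2)}_2=R^{(1)}R'^{(1)}\otimes R'^{(2)}\otimes R^{(2)}$; 3. $R^{(1)}\otimes R^{(2)}_2R'^{(1)}\otimes R^{(2)}_1R'^{(2)}=R^{(1)}\otimes R'^{(1)}R^{(2)}_1\otimes R'^{(2)}R^{(2)}_2$; 4. $R^{(1)}_2R'^{(1)}\otimes R^{(1)}_1R'^{(2)}\otimes R^{(2)}=R'^{(1)}R^{(1)}_1\otimes R'^{(2)}R^{(1)}_2\otimes R^{(2)}$; 5. $\nu(h):=R^{(2)}h_2R'^{(2)}\otimes S(h_1)S(R^{(1)})h_3R'^{(1)}\in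 H\otimes Z(H)$ for all $h\in H$; 6. $\nu(h)=R^{(1)}h_2R'^{(1)}\otimes S(R'^{(2)})S(h_1)R^{(2)}h_3$ for all $h\in H$. A *left-right normal $(H,R)$-module* is a $k$-vector space $M$ with a left $H$-module structure and a right $H$-comodule structure $\nu_M(m)=m_0\otimes m_1$ such that, for all $h\in H$ and $m\in M$, $$\nu_M(m)\in M\otimes Z(H),\qquad \nu_M(h\cdot m)=R^{(2)}h_2R'^{(2)}\cdot m_0\otimes S(h_1)S(R^{(1)})h_3R'^{(1)}m_1 .$$ Morphisms are the $k$-linear maps that are both $H$-linear and $H$-colinear. **Corollary 2.10.** The category of finite-dimensional left-right normal $(H,R)$-modules is a rigid braided category. In detail: (a) The unit object is $k$ with the trivial action and coaction. The tensor product is the tensor product over $k$ with the diagonal action $h\cdot(m\otimes n)=h_1\cdot m\otimes h_2\cdot n$ and the diagonal coaction $m\otimes n\mapsto m_0\otimes n_0\otimes m_1n_1$. With these and the usual associativity and unit constraints, the finite-dimensional left-right normal $(H,R)$-modules form a monoidal category, and it is braided by $$c_{M,N}(m\otimes n)=R^{(2)}\cdot n_0\otimes R^{(1)}n_1\cdot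 m .$$ (b) Every object $M$ has a left dual. The dual vector space $M^*$, with the action $(h\cdot f)(m)=f(S(h)\cdot m)$ and the coaction $$\nu_{M^*}(f)=\sum_i f\big((m_i)_0\big)\,m_i^*\otimes S^{-1}\big((m_i)_1\big),$$ where $\{m_i,m_i^*\}$ are dual bases of $M$, is a finite-dimensional left-right normal $(H,R)$-module. The usual evaluation $\mathrm{ev}_M\colon M^*\otimes M\to k$, $f\otimes m\mapsto f(m)$, and coevaluation $\mathrm{coev}_M\colon k\to M\otimes M^*$, $1\mapsto\sum_i m_i\otimes m_i^*$, are morphisms of normal $(H,R)$-modules, and $$\mathrm{id}_M=(M\otimes\mathrm{ev}_M)(\mathrm{coev}_M\otimes M),\qquad \mathrm{id}_{M^*}=(\mathrm{ev}_M\otimes M^*)(M^*\otimes\mathrm{coev}_M).$$ -/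

import Mathlib

open CategoryTheory MonoidalCategory Coalgebra HopfAlgebra
open scoped TensorProduct

universe u v w

namespace SemiQT

noncomputable section

/-! ### Semiquasitriangular Hopf algebras -/

section Hopf

variable {k : Type u} [Field k] {H : Type v} [Ring H] [HopfAlgebra k H]

/-- `R₁₂ = R⁽¹⁾ ⊗ R⁽²⁾ ⊗ 1` in `H ⊗ (H ⊗ H)`. -/
def leg12 (R : H ⊗[k] H) : H ⊗[k] (H ⊗[k] H) :=
  Algebra.TensorProduct.map (AlgHom.id k H) Algebra.TensorProduct.includeLeft R

/-- `R₁₃ = R⁽¹⁾ ⊗ 1 ⊗ R⁽²⁾` in `H ⊗ (H ⊗ H)`. -/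
def leg13 (R : H ⊗[k] H) : H ⊗[k] (H ⊗[k] H) :=
  Algebra.TensorProduct.map (AlgHom.id k H) Algebra.TensorProduct.includeRight R

/-- `R₂₃ = 1 ⊗ R⁽¹⁾ ⊗ R⁽²⁾` in `H ⊗ (H ⊗ H)`. -/
def leg23 (R : H ⊗[k] H) : H ⊗[k] (H ⊗[k] H) :=
  1 ⊗ₜ[k] R

/-- `(Δ ⊗ H)(R) = R⁽¹⁾₁ ⊗ R⁽¹⁾₂ ⊗ R⁽²⁾`. -/
def comulLeft (R : H ⊗[k] H) : H ⊗[k] (H ⊗[k] H) :=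
  TensorProduct.assoc k H H H ((comul (R := k) (A := H)).rTensor H R)

/-- `(H ⊗ Δ)(R) = R⁽¹⁾ ⊗ R⁽²⁾₁ ⊗ R⁽²⁾₂`. -/
def comulRight (R : H ⊗[k] H) : H ⊗[k] (H ⊗[k] H) :=
  (comul (R := k) (A := H)).lTensor H R

variable (k H) in
/-- The co-opposite comultiplication `h ↦ h₂ ⊗ h₁`. -/
def comulOp : H →ₗ[k] H ⊗[k] H :=
  (TensorProduct.comm k H H).toLinearMap ∘ₗ comul

/-- `R⁽¹⁾₂ ⊗ R⁽¹⁾₁ ⊗ R⁽²⁾`. -/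
def comulOpLeft (R : H ⊗[k] H) : H ⊗[k] (H ⊗[k] H) :=
  TensorProduct.assoc k H H H ((comulOp k H).rTensor H R)

/-- `R⁽¹⁾ ⊗ R⁽²⁾₂ ⊗ R⁽²⁾₁`. -/
def comulOpRight (R : H ⊗[k] H) : H ⊗[k] (H ⊗[k] H) :=
  (comulOp k H).lTensor H R

/-- `τ(R) = R⁽²⁾ ⊗ R⁽¹⁾`. -/
def flip (R : H ⊗[k] H) : H ⊗[k] H :=
  TensorProduct.comm k H H R

/-- `R⁽²⁾ ⊗ S(R⁽¹⁾)`. -/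
def flipAntipode (R : H ⊗[k] H) : H ⊗[k] H :=
  flip ((antipode k (A := H)).rTensor H R)

/-- For a linear endomorphism `L` of `H ⊗ H`, the linear map `h ↦ (1 ⊗ S(h₁)) * L (h₂ ⊗ h₃)`. -/
def antipodeTwist (L : H ⊗[k] H →ₗ[k] H ⊗[k] H) : H →ₗ[k] H ⊗[k] H :=
  TensorProduct.lift
    ((LinearMap.mul k (H ⊗[k] H)).compl₁₂
      ((Algebra.TensorProduct.includeRight : H →ₐ[k] H ⊗[k] H).toLinearMap ∘ₗ antipode k)
      (L ∘ₗ comul)) ∘ₗ comul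

/-- `ν(h) = R⁽²⁾ h₂ R'⁽²⁾ ⊗ S(h₁) S(R⁽¹⁾) h₃ R'⁽¹⁾`. -/
def nu (R : H ⊗[k] H) : H →ₗ[k] H ⊗[k] H :=
  antipodeTwist (LinearMap.mulLeft k (flipAntipode R) ∘ₗ LinearMap.mulRight k (flip R))

/-- The linear map `x ⊗ y ↦ x R⁽¹⁾ ⊗ S(R⁽²⁾) y`. -/
def sandwich (R : H ⊗[k] H) : H ⊗[k] H →ₗ[k] H ⊗[k] H :=
  TensorProduct.homTensorHomMap (RingHom.id k) H H H H
    (TensorProduct.map (LinearMap.mul k H).flip (LinearMap.mul k H ∘ₗ antipode k) R)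

/-- `h ↦ R⁽¹⁾ h₂ R'⁽¹⁾ ⊗ S(R'⁽²⁾) S(h₁) R⁽²⁾ h₃`. -/
def nu' (R : H ⊗[k] H) : H →ₗ[k] H ⊗[k] H :=
  sandwich R ∘ₗ antipodeTwist (LinearMap.mulLeft k R)

variable (k H) in
/-- The subspace `M ⊗ Z(H)` of `M ⊗ H`. -/
def tensorCenter (M : Type w) [AddCommGroup M] [Module k M] : Submodule k (M ⊗[k] H) :=
  LinearMap.range ((Subalgebra.center k H).val.toLinearMap.lTensor M)

/-- `(H, R)` is a semiquasitriangular Hopf algebra. -/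
structure IsSemiquasitriangular (R : H ⊗[k] H) : Prop where
  bijective_antipode : Function.Bijective (antipode k (A := H))
  isUnit : IsUnit R
  comul_left : comulLeft R = leg13 R * leg23 R
  comul_right : comulRight R = leg13 R * leg12 R
  comul_right_comm : comulOpRight R * leg23 R = leg23 R * comulRight R
  comul_left_comm : comulOpLeft R * leg12 R = leg12 R * comulLeft R
  nu_mem (h : H) : nu R h ∈ tensorCenter k H H
  nu_eq (h : H) : nu R h = nu' R h

variable (k) in
/-- The inverse `S⁻¹` of a bijective antipode. -/
def antipodeInv (hS : Function.Bijective (antipode k (A := H))) : H →ₗ[k] H :=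
  (LinearEquiv.ofBijective (antipode k (A := H)) hS).symm

lemma antipode_antipodeInv (hS : Function.Bijective (antipode k (A := H))) (h : H) :
    antipode k (antipodeInv k hS h) = h :=
  (LinearEquiv.ofBijective (antipode k (A := H)) hS).apply_symm_apply h

lemma antipodeInv_antipode (hS : Function.Bijective (antipode k (A := H))) (h : H) :
    antipodeInv k hS (antipode k h) = h :=
  (LinearEquiv.ofBijective (antipode k (A := H)) hS).symm_apply_apply h

section AntipodeComul

variable (k H) in
/-- `a ↦ (b ⊗ (c ⊗ d) ↦ S(b) c ⊗ S(a) d)`. -/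
def auxL : H →ₗ[k] H ⊗[k] (H ⊗[k] H) →ₗ[k] H ⊗[k] H :=
  LinearMap.lcomp k _ (TensorProduct.assoc k H H H).symm.toLinearMap ∘ₗ
    TensorProduct.mapBilinear (RingHom.id k) (H ⊗[k] H) H H H
      (LinearMap.mul' k H ∘ₗ (antipode k).rTensor H) ∘ₗ
    LinearMap.mul k H ∘ₗ antipode k

lemma auxL_comul (a x : H) :
    auxL k H a ((comul (R := k)).lTensor H (comul x)) = 1 ⊗ₜ (antipode k a * x) := by
  rw [← Coalgebra.coassoc_apply]
  have h : ∀ t : H ⊗[k] H,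
      auxL k H a (TensorProduct.assoc k H H H ((comul (R := k)).rTensor H t)) =
        1 ⊗ₜ (antipode k a * TensorProduct.lid k H ((counit (R := k)).rTensor H t)) := by
    intro t
    induction t with
    | zero => simp
    | add s t hs ht => simp only [map_add, hs, ht, mul_add, TensorProduct.tmul_add]
    | tmul y z =>
      simp [auxL, Algebra.algebraMap_eq_smul_one, TensorProduct.smul_tmul]
  rw [h]
  simp

lemma auxG (h : H) :
    LinearMap.mul' k (H ⊗[k] H) (TensorProduct.map
      (TensorProduct.map (antipode k) (antipode k) ∘ₗ comulOp k H) comul (comul h)) =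
      algebraMap k (H ⊗[k] H) (counit h) := by
  have key : ∀ t : H ⊗[k] (H ⊗[k] H),
      LinearMap.mul' k (H ⊗[k] H) (TensorProduct.map
        (TensorProduct.map (antipode k) (antipode k) ∘ₗ (TensorProduct.comm k H H).toLinearMap)
        comul ((TensorProduct.assoc k H H H).symm t)) =
      TensorProduct.lift (auxL k H)
        (((comul (R := k)).lTensor H).lTensor H t) := by
    intro t
    induction t with
    | zero => simp
    | add s t hs ht => simp only [map_add, hs, ht]
    | tmul x t =>
      induction t with
      | zero => simp
      | add s t hs ht => simp only [TensorProduct.tmul_add, map_add, hs, ht]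
      | tmul y z =>
        simp only [TensorProduct.assoc_symm_tmul, TensorProduct.map_tmul, LinearMap.comp_apply,
          LinearEquiv.coe_coe, TensorProduct.comm_tmul, LinearMap.mul'_apply,
          LinearMap.lTensor_tmul, TensorProduct.lift.tmul]
        generalize comul (R := k) z = w
        induction w with
        | zero => simp
        | add s t hs ht => simp only [TensorProduct.tmul_add, map_add, hs, ht, mul_add]
        | tmul c d => simp [auxL]
  have e : TensorProduct.map
      (TensorProduct.map (antipode k) (antipode k) ∘ₗ comulOp k H) comul (comul h) =
      TensorProduct.map
        (TensorProduct.map (antipode k) (antipode k) ∘ₗ (TensorProduct.comm k H H).toLinearMap)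
        (comul (R := k) (A := H)) ((TensorProduct.assoc k H H H).symm
          ((comul (R := k)).lTensor H (comul h))) := by
    rw [Coalgebra.coassoc_symm_apply, ← LinearMap.comp_apply (TensorProduct.map _ _) (LinearMap.rTensor _ _),
      LinearMap.map_comp_rTensor]
    rfl
  rw [e, key]
  have k2 : ∀ t : H ⊗[k] H, TensorProduct.lift (auxL k H)
        (((comul (R := k)).lTensor H).lTensor H ((comul (R := k)).lTensor H t)) =
        1 ⊗ₜ LinearMap.mul' k H ((antipode k).rTensor H t) := by
    intro t
    induction t with
    | zero => simp
    | add s t hs ht => simp only [map_add, hs, ht, TensorProduct.tmul_add]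
    | tmul x y => simp [auxL_comul]
  rw [k2]
  simp [Algebra.algebraMap_eq_smul_one, Algebra.TensorProduct.one_def]

/-- The antipode reverses the comultiplication. -/
lemma comul_antipode (h : H) :
    comul (antipode k h) =
      TensorProduct.map (antipode k) (antipode k) (comulOp k H h) := by
  have h1 := LinearMap.comul_right_inv (R := k) (C := H)
  have h2 : WithConv.toConv (TensorProduct.map (antipode k) (antipode k) ∘ₗ comulOp k H) *
      WithConv.toConv (comul (R := k) (A := H)) = 1 := by
    apply WithConv.ext
    ext x
    exact auxG x
  have h3 := left_inv_eq_right_inv h2 h1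
  exact (congr(($h3).ofConv h)).symm

/-- The inverse antipode reverses the comultiplication. -/
lemma comul_antipodeInv (hS : Function.Bijective (antipode k (A := H))) (h : H) :
    comul (antipodeInv k hS h) =
      TensorProduct.map (antipodeInv k hS) (antipodeInv k hS) (comulOp k H h) := by
  obtain ⟨g, rfl⟩ := hS.2 h
  have e : comulOp k H (antipode k g) =
      TensorProduct.map (antipode k) (antipode k) (comul g) := by
    simp only [comulOp, LinearMap.comp_apply, comul_antipode, LinearEquiv.coe_coe]
    generalize comul (R := k) g = t
    induction t with
    | zero => simp
    | add s t hs ht => simp only [map_add, hs, ht]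
    | tmul x y => simp
  rw [antipodeInv_antipode, e]
  generalize comul (R := k) g = t
  induction t with
  | zero => simp
  | add s t hs ht => simp only [map_add, ← hs, ← ht]
  | tmul x y => simp [antipodeInv_antipode]

lemma counit_antipodeInv (hS : Function.Bijective (antipode k (A := H))) (h : H) :
    counit (R := k) (antipodeInv k hS h) = counit (R := k) h := by
  obtain ⟨g, rfl⟩ := hS.2 h
  rw [antipodeInv_antipode, counit_antipode]

end AntipodeComul

end Hopf

/-! ### Diagonal actions and coactions -/

section Diagonal

variable {k : Type u} [Field k] {H : Type v} [Ring H] [HopfAlgebra k H]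
  {V W U V' W' : Type*} [AddCommGroup V] [Module k V] [AddCommGroup W] [Module k W]
  [AddCommGroup U] [Module k U] [AddCommGroup V'] [Module k V'] [AddCommGroup W'] [Module k W']

/-- The linear map `(m ⊗ a) ⊗ (n ⊗ b) ↦ (m ⊗ n) ⊗ a b`. -/
def mulLegs (V W A : Type*) [AddCommGroup V] [Module k V] [AddCommGroup W] [Module k W]
    [Ring A] [Algebra k A] : (V ⊗[k] A) ⊗[k] (W ⊗[k] A) →ₗ[k] (V ⊗[k] W) ⊗[k] A :=
  (LinearMap.mul' k A).lTensor (V ⊗[k] W) ∘ₗ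
    (TensorProduct.tensorTensorTensorComm k V A W A).toLinearMap

@[simp] lemma mulLegs_tmul {A : Type*} [Ring A] [Algebra k A] (m : V) (a : A) (n : W) (b : A) :
    mulLegs (k := k) V W A ((m ⊗ₜ a) ⊗ₜ (n ⊗ₜ b)) = (m ⊗ₜ n) ⊗ₜ (a * b) := by
  simp [mulLegs]

/-- The diagonal action `h · (m ⊗ n) = h₁ · m ⊗ h₂ · n`. -/
def diagAct (ρ : H →ₐ[k] Module.End k V) (σ : H →ₐ[k] Module.End k W) :
    H →ₐ[k] Module.End k (V ⊗[k] W) :=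
  (Module.endTensorEndAlgHom (R := k) (S := k) (A := k) (M := V) (N := W)).comp
    ((Algebra.TensorProduct.map ρ σ).comp (Bialgebra.comulAlgHom k H))

/-- The diagonal coaction `m ⊗ n ↦ m₀ ⊗ n₀ ⊗ m₁ n₁`. -/
def diagCoact (ν : V →ₗ[k] V ⊗[k] H) (ξ : W →ₗ[k] W ⊗[k] H) :
    V ⊗[k] W →ₗ[k] (V ⊗[k] W) ⊗[k] H :=
  mulLegs V W H ∘ₗ TensorProduct.map ν ξ

lemma diagAct_tmul (ρ : H →ₐ[k] Module.End k V) (σ : H →ₐ[k] Module.End k W)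
    (h : H) (m : V) (n : W) :
    diagAct ρ σ h (m ⊗ₜ n) = TensorProduct.map (ρ.toLinearMap.flip m)
      (σ.toLinearMap.flip n) (comul (R := k) h) := by
  simp only [diagAct, AlgHom.comp_apply, Bialgebra.comulAlgHom_apply]
  generalize comul (R := k) h = t
  induction t with
  | zero => simp
  | add s t hs ht => simp only [map_add, LinearMap.add_apply, hs, ht]
  | tmul x y => simp [Module.endTensorEndAlgHom_apply]

lemma diagCoact_tmul (ν : V →ₗ[k] V ⊗[k] H) (ξ : W →ₗ[k] W ⊗[k] H) (m : V) (n : W) :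
    diagCoact ν ξ (m ⊗ₜ n) = mulLegs V W H (ν m ⊗ₜ ξ n) := rfl

lemma diagCoact_coassoc_aux (ν : V →ₗ[k] V ⊗[k] H) (ξ : W →ₗ[k] W ⊗[k] H)
    (X : V ⊗[k] H) (Y : W ⊗[k] H) :
    TensorProduct.assoc k (V ⊗[k] W) H H ((diagCoact ν ξ).rTensor H (mulLegs V W H (X ⊗ₜ Y))) =
    mulLegs V W (H ⊗[k] H) (TensorProduct.assoc k V H H (ν.rTensor H X) ⊗ₜ
      TensorProduct.assoc k W H H (ξ.rTensor H Y)) := by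
  induction X with
  | zero => simp
  | add s t hs ht => simp only [TensorProduct.add_tmul, map_add, hs, ht]
  | tmul m a =>
  induction Y with
  | zero => simp
  | add s t hs ht => simp only [TensorProduct.tmul_add, map_add, hs, ht]
  | tmul n b =>
  simp only [mulLegs_tmul, LinearMap.rTensor_tmul, diagCoact_tmul]
  generalize ν m = X
  generalize ξ n = Y
  induction X with
  | zero => simp
  | add s t hs ht => simp only [TensorProduct.add_tmul, map_add, hs, ht]
  | tmul m a =>
  induction Y with
  | zero => simp
  | add s t hs ht => simp only [TensorProduct.tmul_add, TensorProduct.add_tmul, map_add, hs, ht]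
  | tmul n b => simp

lemma mulLegs_comul (X : V ⊗[k] H) (Y : W ⊗[k] H) :
    (comul (R := k) (A := H)).lTensor (V ⊗[k] W) (mulLegs V W H (X ⊗ₜ Y)) =
    mulLegs V W (H ⊗[k] H) ((comul (R := k) (A := H)).lTensor V X ⊗ₜ
      (comul (R := k) (A := H)).lTensor W Y) := by
  induction X with
  | zero => simp
  | add s t hs ht => simp only [TensorProduct.add_tmul, map_add, hs, ht]
  | tmul m a =>
  induction Y with
  | zero => simp
  | add s t hs ht => simp only [TensorProduct.tmul_add, map_add, hs, ht]
  | tmul n b => simp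

lemma mulLegs_counit (X : V ⊗[k] H) (Y : W ⊗[k] H) :
    (counit (R := k) (A := H)).lTensor (V ⊗[k] W) (mulLegs V W H (X ⊗ₜ Y)) =
    mulLegs V W k ((counit (R := k) (A := H)).lTensor V X ⊗ₜ
      (counit (R := k) (A := H)).lTensor W Y) := by
  induction X with
  | zero => simp
  | add s t hs ht => simp only [TensorProduct.add_tmul, map_add, hs, ht]
  | tmul m a =>
  induction Y with
  | zero => simp
  | add s t hs ht => simp only [TensorProduct.tmul_add, map_add, hs, ht]
  | tmul n b => simp

lemma diagCoact_coassoc (ν : V →ₗ[k] V ⊗[k] H) (ξ : W →ₗ[k] W ⊗[k] H)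
    (hν : ∀ m, TensorProduct.assoc k V H H (ν.rTensor H (ν m)) =
      (comul (R := k) (A := H)).lTensor V (ν m))
    (hξ : ∀ m, TensorProduct.assoc k W H H (ξ.rTensor H (ξ m)) =
      (comul (R := k) (A := H)).lTensor W (ξ m)) (t : V ⊗[k] W) :
    TensorProduct.assoc k (V ⊗[k] W) H H ((diagCoact ν ξ).rTensor H (diagCoact ν ξ t)) =
      (comul (R := k) (A := H)).lTensor (V ⊗[k] W) (diagCoact ν ξ t) := by
  induction t with
  | zero => simp
  | add s t hs ht => simp only [map_add, hs, ht]
  | tmul m n => rw [diagCoact_tmul, diagCoact_coassoc_aux, mulLegs_comul, hν, hξ]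

lemma diagCoact_counit (ν : V →ₗ[k] V ⊗[k] H) (ξ : W →ₗ[k] W ⊗[k] H)
    (hν : ∀ m, (counit (R := k) (A := H)).lTensor V (ν m) = m ⊗ₜ[k] 1)
    (hξ : ∀ m, (counit (R := k) (A := H)).lTensor W (ξ m) = m ⊗ₜ[k] 1) (t : V ⊗[k] W) :
    (counit (R := k) (A := H)).lTensor (V ⊗[k] W) (diagCoact ν ξ t) = t ⊗ₜ[k] 1 := by
  induction t with
  | zero => simp
  | add s t hs ht => simp only [map_add, hs, ht, TensorProduct.add_tmul]
  | tmul m n =>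
    rw [diagCoact_tmul, mulLegs_counit, hν, hξ]
    simp

lemma map_diagAct (ρ : H →ₐ[k] Module.End k V) (σ : H →ₐ[k] Module.End k W)
    (ρ' : H →ₐ[k] Module.End k V') (σ' : H →ₐ[k] Module.End k W')
    (f : V →ₗ[k] V') (g : W →ₗ[k] W') (hf : ∀ h m, f (ρ h m) = ρ' h (f m))
    (hg : ∀ h m, g (σ h m) = σ' h (g m)) (h : H) (t : V ⊗[k] W) :
    TensorProduct.map f g (diagAct ρ σ h t) = diagAct ρ' σ' h (TensorProduct.map f g t) := by
  induction t with
  | zero => simp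
  | add s t hs ht => simp only [map_add, hs, ht]
  | tmul m n =>
    rw [TensorProduct.map_tmul, diagAct_tmul, diagAct_tmul]
    generalize comul (R := k) h = t
    induction t with
    | zero => simp
    | add s t hs ht => simp only [map_add, hs, ht]
    | tmul x y => simp [hf, hg]

lemma map_diagCoact (ν : V →ₗ[k] V ⊗[k] H) (ξ : W →ₗ[k] W ⊗[k] H)
    (ν' : V' →ₗ[k] V' ⊗[k] H) (ξ' : W' →ₗ[k] W' ⊗[k] H)
    (f : V →ₗ[k] V') (g : W →ₗ[k] W') (hf : ∀ m, ν' (f m) = f.rTensor H (ν m))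
    (hg : ∀ m, ξ' (g m) = g.rTensor H (ξ m)) (t : V ⊗[k] W) :
    diagCoact ν' ξ' (TensorProduct.map f g t) =
      (TensorProduct.map f g).rTensor H (diagCoact ν ξ t) := by
  induction t with
  | zero => simp
  | add s t hs ht => simp only [map_add, hs, ht]
  | tmul m n =>
    simp only [diagCoact_tmul, TensorProduct.map_tmul, hf, hg]
    generalize ν m = X
    generalize ξ n = Y
    induction X with
    | zero => simp
    | add s t hs ht => simp only [TensorProduct.add_tmul, map_add, hs, ht]
    | tmul m a =>
    induction Y with
    | zero => simp
    | add s t hs ht => simp only [TensorProduct.tmul_add, map_add, hs, ht]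
    | tmul n b => simp

lemma assoc_diagAct (ρ : H →ₐ[k] Module.End k V) (σ : H →ₐ[k] Module.End k W)
    (π : H →ₐ[k] Module.End k U) (h : H) (t : (V ⊗[k] W) ⊗[k] U) :
    TensorProduct.assoc k V W U (diagAct (diagAct ρ σ) π h t) =
      diagAct ρ (diagAct σ π) h (TensorProduct.assoc k V W U t) := by
  have key : (TensorProduct.assoc k V W U).toLinearMap ∘ₗ diagAct (diagAct ρ σ) π h =
      diagAct ρ (diagAct σ π) h ∘ₗ (TensorProduct.assoc k V W U).toLinearMap := by
    apply TensorProduct.ext_threefold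
    intro m n p
    have e1 : ∀ t : H ⊗[k] H, TensorProduct.assoc k V W U
        (TensorProduct.map ((diagAct ρ σ).toLinearMap.flip (m ⊗ₜ n)) (π.toLinearMap.flip p) t) =
        TensorProduct.map (ρ.toLinearMap.flip m) (TensorProduct.map (σ.toLinearMap.flip n)
          (π.toLinearMap.flip p)) (TensorProduct.assoc k H H H
            ((comul (R := k) (A := H)).rTensor H t)) := by
      intro t
      induction t with
      | zero => simp
      | add s t hs ht => simp only [map_add, hs, ht]
      | tmul x y =>
        simp only [TensorProduct.map_tmul, LinearMap.flip_apply, AlgHom.toLinearMap_apply,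
          diagAct_tmul, LinearMap.rTensor_tmul]
        generalize comul (R := k) x = w
        induction w with
        | zero => simp
        | add s t hs ht => simp only [TensorProduct.add_tmul, map_add, hs, ht]
        | tmul c d => simp
    have e2 : ∀ t : H ⊗[k] H,
        TensorProduct.map (ρ.toLinearMap.flip m) ((diagAct σ π).toLinearMap.flip (n ⊗ₜ p)) t =
        TensorProduct.map (ρ.toLinearMap.flip m) (TensorProduct.map (σ.toLinearMap.flip n)
          (π.toLinearMap.flip p)) ((comul (R := k) (A := H)).lTensor H t) := by
      intro t
      induction t with
      | zero => simp
      | add s t hs ht => simp only [map_add, hs, ht]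
      | tmul x y => simp [diagAct_tmul]
    simp only [LinearMap.comp_apply, LinearEquiv.coe_coe, TensorProduct.assoc_tmul]
    rw [diagAct_tmul, diagAct_tmul, e1, e2, Coalgebra.coassoc_apply]
  exact congr($key t)

lemma assoc_diagCoact (ν : V →ₗ[k] V ⊗[k] H) (ξ : W →ₗ[k] W ⊗[k] H) (π : U →ₗ[k] U ⊗[k] H)
    (t : (V ⊗[k] W) ⊗[k] U) :
    diagCoact ν (diagCoact ξ π) (TensorProduct.assoc k V W U t) =
      (TensorProduct.assoc k V W U).toLinearMap.rTensor H (diagCoact (diagCoact ν ξ) π t) := by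
  have key : diagCoact ν (diagCoact ξ π) ∘ₗ (TensorProduct.assoc k V W U).toLinearMap =
      (TensorProduct.assoc k V W U).toLinearMap.rTensor H ∘ₗ diagCoact (diagCoact ν ξ) π := by
    apply TensorProduct.ext_threefold
    intro m n p
    simp only [LinearMap.comp_apply, LinearEquiv.coe_coe, TensorProduct.assoc_tmul,
      diagCoact_tmul]
    generalize ν m = X
    generalize ξ n = Y
    generalize π p = Z
    induction X with
    | zero => simp
    | add s t hs ht => simp only [TensorProduct.add_tmul, map_add, hs, ht]
    | tmul m a =>
    induction Y with
    | zero => simp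
    | add s t hs ht =>
      simp only [TensorProduct.add_tmul, TensorProduct.tmul_add, map_add, hs, ht]
    | tmul n b =>
    induction Z with
    | zero => simp
    | add s t hs ht => simp only [TensorProduct.tmul_add, map_add, hs, ht]
    | tmul p c => simp [mul_assoc]
  exact congr($key t)

variable (k H) in
/-- The trivial action `h · c = ε(h) c` of `H` on `k`. -/
def trivialAct : H →ₐ[k] Module.End k k :=
  (Algebra.ofId k (Module.End k k)).comp (Bialgebra.counitAlgHom k H)

variable (k H) in
/-- The trivial coaction `c ↦ c ⊗ 1` of `H` on `k`. -/
def trivialCoact : k →ₗ[k] k ⊗[k] H :=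
  (TensorProduct.mk k k H).flip 1

lemma lid_diagAct (ρ : H →ₐ[k] Module.End k V) (h : H) (t : k ⊗[k] V) :
    TensorProduct.lid k V (diagAct (trivialAct k H) ρ h t) = ρ h (TensorProduct.lid k V t) := by
  induction t with
  | zero => simp
  | add s t hs ht => simp only [map_add, hs, ht]
  | tmul c m =>
    rw [diagAct_tmul]
    have e : ∀ t : H ⊗[k] H, TensorProduct.lid k V
        (TensorProduct.map ((trivialAct k H).toLinearMap.flip c) (ρ.toLinearMap.flip m) t) =
        c • ρ (TensorProduct.lid k H ((counit (R := k)).rTensor H t)) m := by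
      intro t
      induction t with
      | zero => simp
      | add s t hs ht => simp only [map_add, hs, ht, LinearMap.add_apply, smul_add]
      | tmul x y =>
        simp [trivialAct, Algebra.ofId_apply, Algebra.algebraMap_eq_smul_one, smul_smul, mul_comm]
    rw [e]
    simp

lemma rid_diagAct (ρ : H →ₐ[k] Module.End k V) (h : H) (t : V ⊗[k] k) :
    TensorProduct.rid k V (diagAct ρ (trivialAct k H) h t) = ρ h (TensorProduct.rid k V t) := by
  induction t with
  | zero => simp
  | add s t hs ht => simp only [map_add, hs, ht]
  | tmul m c =>
    rw [diagAct_tmul]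
    have e : ∀ t : H ⊗[k] H, TensorProduct.rid k V
        (TensorProduct.map (ρ.toLinearMap.flip m) ((trivialAct k H).toLinearMap.flip c) t) =
        c • ρ (TensorProduct.rid k H ((counit (R := k)).lTensor H t)) m := by
      intro t
      induction t with
      | zero => simp
      | add s t hs ht => simp only [map_add, hs, ht, LinearMap.add_apply, smul_add]
      | tmul x y =>
        simp [trivialAct, Algebra.ofId_apply, Algebra.algebraMap_eq_smul_one, smul_smul, mul_comm]
    rw [e]
    simp

lemma lid_diagCoact (ν : V →ₗ[k] V ⊗[k] H) (t : k ⊗[k] V) :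
    ν (TensorProduct.lid k V t) = (TensorProduct.lid k V).toLinearMap.rTensor H
      (diagCoact (trivialCoact k H) ν t) := by
  induction t with
  | zero => simp
  | add s t hs ht => simp only [map_add, hs, ht]
  | tmul c m =>
    simp only [diagCoact_tmul, TensorProduct.lid_tmul, map_smul, trivialCoact,
      LinearMap.flip_apply, TensorProduct.mk_apply]
    generalize ν m = X
    induction X with
    | zero => simp
    | add s t hs ht => simp only [TensorProduct.tmul_add, map_add, hs, ht, smul_add]
    | tmul m a => simp [TensorProduct.smul_tmul']

lemma rid_diagCoact (ν : V →ₗ[k] V ⊗[k] H) (t : V ⊗[k] k) :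
    ν (TensorProduct.rid k V t) = (TensorProduct.rid k V).toLinearMap.rTensor H
      (diagCoact ν (trivialCoact k H) t) := by
  induction t with
  | zero => simp
  | add s t hs ht => simp only [map_add, hs, ht]
  | tmul m c =>
    simp only [diagCoact_tmul, TensorProduct.rid_tmul, map_smul, trivialCoact,
      LinearMap.flip_apply, TensorProduct.mk_apply]
    generalize ν m = X
    induction X with
    | zero => simp
    | add s t hs ht => simp only [TensorProduct.add_tmul, map_add, hs, ht, smul_add]
    | tmul m a => simp [TensorProduct.smul_tmul']

end Diagonal

/-! ### Spaces with a left action and a right coaction -/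

/-- A vector space over `k` with a left `H`-module structure (given by the algebra map `act`) and a
right `H`-comodule structure (given by `coact`), with no compatibility between the two. -/
structure ActCoact (k : Type u) [Field k] (H : Type v) [Ring H] [HopfAlgebra k H] where
  carrier : Type u
  [addCommGroup : AddCommGroup carrier]
  [module : Module k carrier]
  act : H →ₐ[k] Module.End k carrier
  coact : carrier →ₗ[k] carrier ⊗[k] H
  coassoc (m : carrier) :
    TensorProduct.assoc k carrier H H (coact.rTensor H (coact m)) =
      (comul (R := k) (A := H)).lTensor carrier (coact m)
  counit_coact (m : carrier) :
    (counit (R := k) (A := H)).lTensor carrier (coact m) = m ⊗ₜ[k] 1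

namespace ActCoact

attribute [instance] addCommGroup module

variable {k : Type u} [Field k] {H : Type v} [Ring H] [HopfAlgebra k H]

instance : CoeSort (ActCoact k H) (Type u) := ⟨carrier⟩

/-- A linear map which is a morphism of `H`-modules and of `H`-comodules. -/
@[ext]
structure Hom (M N : ActCoact k H) where
  toLin : M →ₗ[k] N
  map_act (h : H) (m : M) : toLin (M.act h m) = N.act h (toLin m)
  map_coact (m : M) : N.coact (toLin m) = toLin.rTensor H (M.coact m)

instance : Category (ActCoact k H) where
  Hom := Hom
  id M := ⟨LinearMap.id, fun _ _ => rfl, fun _ => by simp⟩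
  comp f g := ⟨g.toLin ∘ₗ f.toLin,
    fun h m => by simp [f.map_act, g.map_act],
    fun m => by simp [f.map_coact, g.map_coact, LinearMap.rTensor_comp]⟩

@[ext]
lemma hom_ext {M N : ActCoact k H} {f g : M ⟶ N} (h : f.toLin = g.toLin) : f = g :=
  Hom.ext h

@[simp] lemma id_toLin (M : ActCoact k H) : Hom.toLin (𝟙 M) = LinearMap.id := rfl

@[simp] lemma comp_toLin {M N P : ActCoact k H} (f : M ⟶ N) (g : N ⟶ P) :
    Hom.toLin (f ≫ g) = g.toLin ∘ₗ f.toLin := rfl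

/-- A bijective morphism is an isomorphism. -/
def isoMk {M N : ActCoact k H} (e : M ≃ₗ[k] N)
    (h1 : ∀ (h : H) (m : M), e (M.act h m) = N.act h (e m))
    (h2 : ∀ m : M, N.coact (e m) = e.toLinearMap.rTensor H (M.coact m)) : M ≅ N where
  hom := ⟨e.toLinearMap, h1, h2⟩
  inv := ⟨e.symm.toLinearMap,
    fun h n => by
      obtain ⟨m, rfl⟩ := e.surjective n
      simp [← h1],
    fun n => by
      obtain ⟨m, rfl⟩ := e.surjective n
      simp only [LinearEquiv.coe_coe, LinearEquiv.symm_apply_apply, h2]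
      rw [← LinearMap.comp_apply, ← LinearMap.rTensor_comp]
      simp⟩
  hom_inv_id := by ext; simp
  inv_hom_id := by ext; simp

/-- The tensor product over `k`, with the diagonal action and the diagonal coaction. -/
def tensor (M N : ActCoact k H) : ActCoact k H where
  carrier := M ⊗[k] N
  act := diagAct M.act N.act
  coact := diagCoact M.coact N.coact
  coassoc := diagCoact_coassoc _ _ M.coassoc N.coassoc
  counit_coact := diagCoact_counit _ _ M.counit_coact N.counit_coact

variable (k H) in
/-- The unit object `k`, with the trivial action and the trivial coaction. -/
def unit : ActCoact k H where
  carrier := k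
  act := trivialAct k H
  coact := trivialCoact k H
  coassoc c := by simp [trivialCoact, Algebra.TensorProduct.one_def]
  counit_coact c := by simp [trivialCoact]

/-- The tensor product of morphisms. -/
def tensorMap {M M' N N' : ActCoact k H} (f : M ⟶ M') (g : N ⟶ N') :
    tensor M N ⟶ tensor M' N' where
  toLin := TensorProduct.map f.toLin g.toLin
  map_act := map_diagAct _ _ _ _ _ _ f.map_act g.map_act
  map_coact := map_diagCoact _ _ _ _ _ _ f.map_coact g.map_coact

/-- The monoidal structure: tensor products over `k` with the diagonal action and coaction, and
the usual associativity and unit constraints. -/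
instance : MonoidalCategoryStruct (ActCoact k H) where
  tensorObj := tensor
  tensorHom := tensorMap
  whiskerLeft M _ _ f := tensorMap (𝟙 M) f
  whiskerRight f N := tensorMap f (𝟙 N)
  tensorUnit := unit k H
  associator M N P := isoMk (M := tensor (tensor M N) P) (N := tensor M (tensor N P))
    (TensorProduct.assoc k M N P) (assoc_diagAct _ _ _) (assoc_diagCoact _ _ _)
  leftUnitor M := isoMk (M := tensor (unit k H) M) (TensorProduct.lid k M)
    (lid_diagAct (k := k) M.act) (lid_diagCoact (k := k) M.coact)
  rightUnitor M := isoMk (M := tensor M (unit k H)) (TensorProduct.rid k M)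
    (rid_diagAct (k := k) M.act) (rid_diagCoact (k := k) M.coact)

/-- The forgetful functor to vector spaces. -/
def forgetToModule : ActCoact k H ⥤ ModuleCat.{u} k where
  obj M := ModuleCat.of k M
  map f := ModuleCat.ofHom f.toLin

instance : (forgetToModule (k := k) (H := H)).Faithful where
  map_injective h := hom_ext (congrArg ModuleCat.Hom.hom h)

instance : MonoidalCategory (ActCoact k H) :=
  Monoidal.induced forgetToModule
    { μIso := fun _ _ => Iso.refl _
      εIso := Iso.refl _
      whiskerLeft_eq := fun X Y₁ Y₂ f => by
        ext : 1
        apply TensorProduct.ext'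
        intro x y
        rfl
      whiskerRight_eq := fun f Y => by
        ext : 1
        apply TensorProduct.ext'
        intro x y
        rfl
      tensorHom_eq := fun f g => by
        ext : 1
        apply TensorProduct.ext'
        intro x y
        rfl
      associator_eq := fun X Y Z => by
        ext : 1
        apply TensorProduct.ext_threefold
        intro x y z
        rfl
      leftUnitor_eq := fun X => by
        ext : 1
        apply TensorProduct.ext'
        intro x y
        rfl
      rightUnitor_eq := fun X => by
        ext : 1
        apply TensorProduct.ext'
        intro x y
        rfl }

/-! ### The dual -/

/-- The contragredient action `(h · f)(m) = f(S(h) · m)`. -/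
def dualAct (M : ActCoact k H) : H →ₐ[k] Module.End k (Module.Dual k M) :=
  AlgHom.ofLinearMap
    (Module.Dual.transpose (R := k) (M := M) (M' := M) ∘ₗ M.act.toLinearMap ∘ₗ antipode k)
    (by ext f m; simp [Module.Dual.transpose_apply])
    (by intro x y; ext f m; simp [Module.Dual.transpose_apply, antipode_mul_antidistrib])

lemma dualAct_apply (M : ActCoact k H) (h : H) (f : Module.Dual k M) (m : M) :
    dualAct M h f m = f (M.act (antipode k h) m) := rfl

/-- `f ↦ (m ⊗ h ↦ f(m) h)`. -/
def evalLeft (V : Type*) [AddCommGroup V] [Module k V] :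
    Module.Dual k V →ₗ[k] V ⊗[k] H →ₗ[k] H :=
  LinearMap.llcomp k (V ⊗[k] H) (k ⊗[k] H) H (TensorProduct.lid k H).toLinearMap ∘ₗ
    LinearMap.rTensorHom H

@[simp] lemma evalLeft_tmul {V : Type*} [AddCommGroup V] [Module k V]
    (f : Module.Dual k V) (m : V) (h : H) : evalLeft V f (m ⊗ₜ[k] h) = f m • h := by
  simp [evalLeft]

/-- The coaction `ν(f) = ∑ᵢ f((mᵢ)₀) mᵢ* ⊗ S⁻¹((mᵢ)₁)` on `M*`, where `(mᵢ, mᵢ*)` are dual bases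
of `M`. -/
def dualCoact (M : ActCoact k H) [FiniteDimensional k M]
    (hS : Function.Bijective (antipode k (A := H))) :
    Module.Dual k M →ₗ[k] Module.Dual k M ⊗[k] H :=
  ∑ i, TensorProduct.mk k (Module.Dual k M) H ((Module.finBasis k M).coord i) ∘ₗ
    antipodeInv k hS ∘ₗ (evalLeft (k := k) M).flip (M.coact (Module.finBasis k M i))

lemma dualCoact_apply (M : ActCoact k H) [FiniteDimensional k M]
    (hS : Function.Bijective (antipode k (A := H))) (f : Module.Dual k M) :
    dualCoact M hS f = ∑ i, (Module.finBasis k M).coord i ⊗ₜ[k]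
      antipodeInv k hS (evalLeft M f (M.coact (Module.finBasis k M i))) := by
  simp [dualCoact]

/-- The dual `M*` with the contragredient action and the coaction built from `S⁻¹`. -/
def dual (M : ActCoact k H) [FiniteDimensional k M]
    (hS : Function.Bijective (antipode k (A := H))) : ActCoact k H where
  carrier := Module.Dual k M
  act := dualAct M
  coact := dualCoact M hS
  coassoc f := by
    set b := Module.finBasis k M
    have expand : ∀ t : M ⊗[k] H, t = ∑ i, b i ⊗ₜ[k] evalLeft M (b.coord i) t := by
      intro t
      induction t with
      | zero => simp
      | add s t hs ht =>
        conv_lhs => rw [hs, ht]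
        simp [TensorProduct.tmul_add, Finset.sum_add_distrib]
      | tmul m h =>
        have hm := congrArg (fun x => x ⊗ₜ[k] h) (b.sum_repr m)
        simp only [TensorProduct.sum_tmul, TensorProduct.smul_tmul] at hm
        simpa using hm.symm
    have e1 : ∀ t : M ⊗[k] H, comul (R := k) (evalLeft M f t) =
        TensorProduct.lid k (H ⊗[k] H) (LinearMap.rTensor (H ⊗[k] H) f
          ((comul (R := k) (A := H)).lTensor M t)) := by
      intro t
      induction t with
      | zero => simp
      | add s t hs ht => simp only [map_add, hs, ht]
      | tmul m h => simp
    have e2 : ∀ t : M ⊗[k] H, TensorProduct.lid k (H ⊗[k] H) (LinearMap.rTensor (H ⊗[k] H) f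
          (TensorProduct.assoc k M H H (M.coact.rTensor H t))) =
        ∑ i, evalLeft M f (M.coact (b i)) ⊗ₜ[k] evalLeft M (b.coord i) t := by
      intro t
      conv_lhs => rw [expand t]
      simp only [map_sum, LinearMap.rTensor_tmul]
      refine Finset.sum_congr rfl fun i _ => ?_
      generalize M.coact (b i) = X
      induction X with
      | zero => simp
      | add s t hs ht => simp only [TensorProduct.add_tmul, map_add, hs, ht]
      | tmul m h => simp [TensorProduct.smul_tmul']
    have e3 : ∀ m : M, comul (R := k) (antipodeInv k hS (evalLeft M f (M.coact m))) =
        ∑ i, antipodeInv k hS (evalLeft M (b.coord i) (M.coact m)) ⊗ₜ[k]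
          antipodeInv k hS (evalLeft M f (M.coact (b i))) := by
      intro m
      rw [comul_antipodeInv, comulOp, LinearMap.comp_apply, e1, ← M.coassoc, e2]
      simp
    simp only [dualCoact_apply, map_sum, LinearMap.rTensor_tmul, LinearMap.lTensor_tmul, e3,
      TensorProduct.sum_tmul, TensorProduct.tmul_sum, TensorProduct.assoc_tmul]
    exact Finset.sum_comm
  counit_coact f := by
    have e : ∀ t : M ⊗[k] H, counit (R := k) (evalLeft M f t) =
        f (TensorProduct.rid k M ((counit (R := k) (A := H)).lTensor M t)) := by
      intro t
      induction t with
      | zero => simp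
      | add s t hs ht => simp only [map_add, hs, ht]
      | tmul m h => simp [mul_comm]
    simp only [dualCoact_apply, map_sum, LinearMap.lTensor_tmul, counit_antipodeInv, e,
      M.counit_coact, TensorProduct.rid_tmul, one_smul]
    have : ∀ i, (Module.finBasis k M).coord i ⊗ₜ[k] f (Module.finBasis k M i) =
        (f (Module.finBasis k M i) • (Module.finBasis k M).coord i) ⊗ₜ[k] (1 : k) := by
      intro i
      rw [TensorProduct.smul_tmul, smul_eq_mul, mul_one]
    simp only [this, ← TensorProduct.sum_tmul]
    congr 1
    exact (Module.finBasis k M).sum_dual_apply_smul_coord f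

/-! ### Normal modules -/

/-- The action of `H ⊗ H` on `M ⊗ H` given by `(a ⊗ b) · (m ⊗ h) = a · m ⊗ b h`. -/
def actOn (M : ActCoact k H) : H ⊗[k] H →ₗ[k] Module.End k (M ⊗[k] H) :=
  TensorProduct.homTensorHomMap (RingHom.id k) M H M H ∘ₗ
    TensorProduct.map M.act.toLinearMap (LinearMap.mul k H)

/-- `M` is a left-right normal `(H, R)`-module: `ν_M(m) ∈ M ⊗ Z(H)` and
`ν_M(h · m) = R⁽²⁾ h₂ R'⁽²⁾ · m₀ ⊗ S(h₁) S(R⁽¹⁾) h₃ R'⁽¹⁾ m₁`. -/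
structure IsNormal (R : H ⊗[k] H) (M : ActCoact k H) : Prop where
  coact_mem (m : M) : M.coact m ∈ tensorCenter k H M
  coact_act (h : H) (m : M) : M.coact (M.act h m) = M.actOn (nu R h) (M.coact m)

/-- `R⁽²⁾ · n₀ ⊗ R⁽¹⁾ n₁ · m` in `N ⊗ M`. -/
def braid (R : H ⊗[k] H) (M N : ActCoact k H) (m : M) (n : N) : N ⊗[k] M :=
  (M.act.toLinearMap.flip m).lTensor N (N.actOn (flip R) (N.coact n))

/-- The finite-dimensional left-right normal `(H, R)`-modules. -/
def finNormal (R : H ⊗[k] H) : ObjectProperty (ActCoact k H) :=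
  fun M => IsNormal R M ∧ FiniteDimensional k M

end ActCoact

/-- The category of finite-dimensional left-right normal `(H, R)`-modules; its morphisms are the
maps which are morphisms of `H`-modules and of `H`-comodules. -/
abbrev FinNormal {k : Type u} [Field k] {H : Type v} [Ring H] [HopfAlgebra k H] (R : H ⊗[k] H) :=
  (ActCoact.finNormal R).FullSubcategory

namespace FinNormal

variable {k : Type u} [Field k] {H : Type v} [Ring H] [HopfAlgebra k H] {R : H ⊗[k] H}

instance (M : FinNormal R) : FiniteDimensional k M.obj :=
  M.property.2

/-- The linear map underlying a morphism. -/
def toLin {M N : FinNormal R} (f : M ⟶ N) : M.obj →ₗ[k] N.obj :=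
  ActCoact.Hom.toLin f.hom

end FinNormal

end

end SemiQT

/-!
# Normal modules over a semiquasitriangular Hopf algebra form a rigid braided category

Write `P = R⁽²⁾ ⊗ R⁽¹⁾` (`flip R`) and `Q = R⁽²⁾ ⊗ S(R⁽¹⁾)` (`flipAntipode R`). Applying the antipode
inside the formula for `(Δ ⊗ H)(R)` gives `Q P = P Q = 1`, and inside the one for `(H ⊗ Δ)(R)` gives
`(S ⊗ S)(R) = R`. The map `ν` is the twist `h ↦ (1 ⊗ S(h₁)) Q Δ(h₂) P`, so it is characterized by

  `(1 ⊗ h₁) ν(h₂) = Q Δ(h) P`  (`conv_inr_nu`).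

Together with `ν(h) ∈ H ⊗ Z(H)` this yields what is needed about `ν`:

* `ν` is multiplicative (`nu_mul`), and `(Δ ⊗ H) ν(h)` is the product of `ν(h₁)` and `ν(h₂)` in legs
  `1, 3` and `2, 3` (`comulFst_nu`), so normal modules are closed under tensor products;
* `ν` is trivial on both legs of `R`, in the sense that `R⁽¹⁾ ⊗ ν(R⁽²⁾) = R⁽¹⁾ ⊗ R⁽²⁾ ⊗ 1`
  (`lTensor_nu`, from the second formula for `ν` and the commutation of `R` with `Δ(R⁽²⁾)`) and
  `ν(R⁽¹⁾) ⊗ R⁽²⁾ = R⁽¹⁾ ⊗ 1 ⊗ R⁽²⁾` (`rTensor_nu`);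
* `ν(S(x)) (1 ⊗ S(z)) = S(h) ⊗ 1` for `x ⊗ z = ν(h)` (`nuAntipode_nu`), which is the normality of
  the dual, read off on elements of `M`.

The braiding is `m ⊗ n ↦ P · (n₀ ⊗ n₁ · m)`. It is `H`-linear by the characterization of `ν` and the
centrality of the coaction, and `H`-colinear because `ν` is trivial on the legs of `R` and
`n₁ ⊗ n₂` is central in `H ⊗ H`. The hexagon identities are the formulas for `(H ⊗ Δ)(R)` and
`(Δ ⊗ H)(R)`. Composing the braiding with the action of `Q` and with `n ⊗ m ↦ n₀ ⊗ S(n₁) · m` gives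
the flip, so the braiding is injective, hence bijective in finite dimension. The evaluation and
coevaluation are colinear because, in the presence of centrality, `S⁻¹` can be used on either side
of the comultiplication; the triangle identities are those of vector spaces.
-/

namespace SemiQT

noncomputable section

/-! ### Convolution -/

section Convolution

variable {k : Type u} [Field k] {H : Type v} [Ring H] [HopfAlgebra k H]
  {B C : Type*} [Ring B] [Algebra k B] [Ring C] [Algebra k C]

/-- The convolution product `h ↦ f(h₁) g(h₂)` of linear maps from `H` to an algebra. -/
def conv (f g : H →ₗ[k] B) : H →ₗ[k] B :=
  LinearMap.mul' k B ∘ₗ TensorProduct.map f g ∘ₗ comul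

lemma conv_apply (f g : H →ₗ[k] B) (h : H) :
    conv f g h = LinearMap.mul' k B (TensorProduct.map f g (comul h)) := rfl

lemma conv_assoc (f g l : H →ₗ[k] B) : conv (conv f g) l = conv f (conv g l) :=
  congr(($(mul_assoc (WithConv.toConv f) (WithConv.toConv g) (WithConv.toConv l))).ofConv)

/-- The unit `h ↦ ε(h) 1` of the convolution product. -/
def convOne (k : Type u) [Field k] (H : Type v) [Ring H] [HopfAlgebra k H]
    (B : Type*) [Ring B] [Algebra k B] : H →ₗ[k] B :=
  Algebra.linearMap k B ∘ₗ counit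

lemma convOne_conv (f : H →ₗ[k] B) : conv (convOne k H B) f = f :=
  congr(($(one_mul (WithConv.toConv f))).ofConv)

lemma algHom_comp_conv (φ : B →ₐ[k] C) (f g : H →ₗ[k] B) :
    φ.toLinearMap ∘ₗ conv f g = conv (φ.toLinearMap ∘ₗ f) (φ.toLinearMap ∘ₗ g) :=
  LinearMap.algHom_comp_convMul_distrib φ (WithConv.toConv f) (WithConv.toConv g)

lemma conv_antipode_self (φ : H →ₐ[k] B) :
    conv (φ.toLinearMap ∘ₗ antipode k) φ.toLinearMap = convOne k H B := by
  have h := algHom_comp_conv φ (antipode k) LinearMap.id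
  rw [LinearMap.comp_id] at h
  rw [← h]
  ext x
  have := congr(($(LinearMap.antipode_mul_id (R := k) (C := H))).ofConv x)
  simp only [LinearMap.comp_apply]
  refine (congrArg _ this).trans ?_
  simp [convOne]

lemma conv_self_antipode (φ : H →ₐ[k] B) :
    conv φ.toLinearMap (φ.toLinearMap ∘ₗ antipode k) = convOne k H B := by
  have h := algHom_comp_conv φ LinearMap.id (antipode k)
  rw [LinearMap.comp_id] at h
  rw [← h]
  ext x
  have := congr(($(LinearMap.id_mul_antipode (R := k) (C := H))).ofConv x)
  simp only [LinearMap.comp_apply]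
  refine (congrArg _ this).trans ?_
  simp [convOne]

lemma conv_mulRight (f g : H →ₗ[k] B) (b : B) :
    conv f (LinearMap.mulRight k b ∘ₗ g) = LinearMap.mulRight k b ∘ₗ conv f g := by
  ext h
  simp only [conv_apply, LinearMap.comp_apply]
  generalize comul (R := k) h = t
  induction t with
  | zero => simp
  | add s t hs ht => simp only [map_add, hs, ht]
  | tmul x y => simp [mul_assoc]

lemma conv_mulLeft (f g : H →ₗ[k] B) (b : B) :
    conv (LinearMap.mulLeft k b ∘ₗ f) g = LinearMap.mulLeft k b ∘ₗ conv f g := by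
  ext h
  simp only [conv_apply, LinearMap.comp_apply]
  generalize comul (R := k) h = t
  induction t with
  | zero => simp
  | add s t hs ht => simp only [map_add, hs, ht]
  | tmul x y => simp [mul_assoc]

/-- An element may be moved through a convolution product if it commutes with a factor. -/
lemma conv_mulRight_comm (f g : H →ₗ[k] B) (b : B) (hb : ∀ x, b * g x = g x * b) :
    conv (LinearMap.mulRight k b ∘ₗ f) g = LinearMap.mulRight k b ∘ₗ conv f g := by
  ext h
  simp only [conv_apply, LinearMap.comp_apply]
  generalize comul (R := k) h = t
  induction t with
  | zero => simp
  | add s t hs ht => simp only [map_add, hs, ht]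
  | tmul x y => simp [mul_assoc, hb]

lemma conv_mulLeft_comm (f g : H →ₗ[k] B) (b : B) (hb : ∀ x, f x * b = b * f x) :
    conv f (LinearMap.mulLeft k b ∘ₗ g) = LinearMap.mulLeft k b ∘ₗ conv f g := by
  ext h
  simp only [conv_apply, LinearMap.comp_apply]
  generalize comul (R := k) h = t
  induction t with
  | zero => simp
  | add s t hs ht => simp only [map_add, hs, ht]
  | tmul x y => simp [← mul_assoc, hb]

variable (k H) in
/-- `h ↦ 1 ⊗ h`. -/
def inr : H →ₐ[k] H ⊗[k] H := Algebra.TensorProduct.includeRight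

variable (k H) in
/-- `h ↦ h ⊗ 1`. -/
def inl : H →ₐ[k] H ⊗[k] H := Algebra.TensorProduct.includeLeft

@[simp] lemma inr_apply (h : H) : inr k H h = 1 ⊗ₜ h := rfl

@[simp] lemma inl_apply (h : H) : inl k H h = h ⊗ₜ 1 := rfl

lemma conv_inl_inr : conv (inl k H).toLinearMap (inr k H).toLinearMap = comul := by
  ext h
  rw [conv_apply]
  generalize comul (R := k) h = t
  induction t with
  | zero => simp
  | add s t hs ht => simp only [map_add, hs, ht]
  | tmul x y => simp

lemma conv_inr_inl : conv (inr k H).toLinearMap (inl k H).toLinearMap = comulOp k H := by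
  ext h
  rw [conv_apply, comulOp, LinearMap.comp_apply]
  generalize comul (R := k) h = t
  induction t with
  | zero => simp
  | add s t hs ht => simp only [map_add, hs, ht]
  | tmul x y => simp

/-- `h ↦ (1 ⊗ S(h₁)) G(h₂)`. -/
def twist (G : H →ₗ[k] H ⊗[k] H) : H →ₗ[k] H ⊗[k] H :=
  conv ((inr k H).toLinearMap ∘ₗ antipode k) G

lemma twist_apply (G : H →ₗ[k] H ⊗[k] H) (h : H) :
    twist G h = LinearMap.mul' k (H ⊗[k] H)
      (TensorProduct.map ((inr k H).toLinearMap ∘ₗ antipode k) G (comul h)) := rfl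

lemma antipodeTwist_eq (L : H ⊗[k] H →ₗ[k] H ⊗[k] H) : antipodeTwist L = twist (L ∘ₗ comul) := by
  ext h
  simp only [antipodeTwist, twist_apply, LinearMap.comp_apply]
  generalize comul (R := k) h = t
  induction t with
  | zero => simp
  | add s t hs ht => simp only [map_add, hs, ht]
  | tmul x y => simp

lemma conv_inr_twist (G : H →ₗ[k] H ⊗[k] H) : conv (inr k H).toLinearMap (twist G) = G := by
  rw [twist, ← conv_assoc, conv_self_antipode, convOne_conv]

lemma twist_conv_inr (G : H →ₗ[k] H ⊗[k] H) : twist (conv (inr k H).toLinearMap G) = G := by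
  rw [twist, ← conv_assoc, conv_antipode_self, convOne_conv]

lemma twist_comulOp : twist (comulOp k H) = (inl k H).toLinearMap := by
  rw [← conv_inr_inl, twist_conv_inr]

lemma twist_mulRight (G : H →ₗ[k] H ⊗[k] H) (b : H ⊗[k] H) :
    twist (LinearMap.mulRight k b ∘ₗ G) = LinearMap.mulRight k b ∘ₗ twist G :=
  conv_mulRight _ _ _

end Convolution

/-! ### Identities for the universal element -/

section Legs

variable {k : Type u} [Field k] {H : Type v} [Ring H] [HopfAlgebra k H]

@[simp] lemma leg12_tmul (a b : H) : leg12 (a ⊗ₜ[k] b) = a ⊗ₜ (b ⊗ₜ 1) := by simp [leg12]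
@[simp] lemma leg13_tmul (a b : H) : leg13 (a ⊗ₜ[k] b) = a ⊗ₜ (1 ⊗ₜ b) := by simp [leg13]
@[simp] lemma leg23_tmul (a b : H) : leg23 (a ⊗ₜ[k] b) = 1 ⊗ₜ (a ⊗ₜ b) := rfl
@[simp] lemma leg12_add (s t : H ⊗[k] H) : leg12 (s + t) = leg12 s + leg12 t := map_add _ _ _
@[simp] lemma leg13_add (s t : H ⊗[k] H) : leg13 (s + t) = leg13 s + leg13 t := map_add _ _ _
@[simp] lemma leg23_add (s t : H ⊗[k] H) : leg23 (s + t) = leg23 s + leg23 t :=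
  TensorProduct.tmul_add _ _ _
@[simp] lemma leg12_zero : leg12 (0 : H ⊗[k] H) = 0 := map_zero _
@[simp] lemma leg13_zero : leg13 (0 : H ⊗[k] H) = 0 := map_zero _
@[simp] lemma leg23_zero : leg23 (0 : H ⊗[k] H) = 0 := TensorProduct.tmul_zero _ _

variable {X : Type*} [AddCommGroup X] [Module k X]

/-- A linear map evaluated at `T₁₃ T'₁₂`, where `T` and `T'` are known through pure tensors. -/
lemma apply_leg13_mul_leg12 (F : H ⊗[k] (H ⊗[k] H) →ₗ[k] X)
    (G : H ⊗[k] H →ₗ[k] H ⊗[k] H →ₗ[k] X)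
    (h : ∀ a b a' b' : H, F ((a * a') ⊗ₜ (b' ⊗ₜ b)) = G (a ⊗ₜ b) (a' ⊗ₜ b')) (T T' : H ⊗[k] H) :
    F (leg13 T * leg12 T') = G T T' := by
  induction T with
  | zero => simp
  | add s t hs ht => simp only [leg13_add, add_mul, map_add, hs, ht, LinearMap.add_apply]
  | tmul a b =>
  induction T' with
  | zero => simp
  | add s t hs ht => simp only [leg12_add, mul_add, map_add, hs, ht]
  | tmul a' b' => simp [← h]

/-- A linear map evaluated at `T₁₃ T'₂₃`, where `T` and `T'` are known through pure tensors. -/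
lemma apply_leg13_mul_leg23 (F : H ⊗[k] (H ⊗[k] H) →ₗ[k] X)
    (G : H ⊗[k] H →ₗ[k] H ⊗[k] H →ₗ[k] X)
    (h : ∀ a b a' b' : H, F (a ⊗ₜ (a' ⊗ₜ (b * b'))) = G (a ⊗ₜ b) (a' ⊗ₜ b')) (T T' : H ⊗[k] H) :
    F (leg13 T * leg23 T') = G T T' := by
  induction T with
  | zero => simp
  | add s t hs ht => simp only [leg13_add, add_mul, map_add, hs, ht, LinearMap.add_apply]
  | tmul a b =>
  induction T' with
  | zero => simp
  | add s t hs ht => simp only [leg23_add, mul_add, map_add, hs, ht]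
  | tmul a' b' => simp [← h]

end Legs

section Universal

variable {k : Type u} [Field k] {H : Type v} [Ring H] [HopfAlgebra k H] {R : H ⊗[k] H}

lemma lTensor_counit_eq (hR : IsSemiquasitriangular R) :
    TensorProduct.rid k H ((counit (R := k) (A := H)).lTensor H R) = 1 := by
  set e : H ⊗[k] H →ₗ[k] H :=
    (TensorProduct.rid k H).toLinearMap ∘ₗ (counit (R := k) (A := H)).lTensor H with he
  have h1 := congrArg ((TensorProduct.lid k H).toLinearMap ∘ₗ
    (counit (R := k) (A := H)).rTensor H |>.lTensor H) hR.comul_right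
  rw [apply_leg13_mul_leg12 _ ((LinearMap.mul k (H ⊗[k] H)).compl₂
    ((inl k H).toLinearMap ∘ₗ e))] at h1
  · have h2 : ((TensorProduct.lid k H).toLinearMap ∘ₗ
        (counit (R := k) (A := H)).rTensor H |>.lTensor H) (comulRight R) = R := by
      rw [comulRight, ← LinearMap.comp_apply, ← LinearMap.lTensor_comp, LinearMap.comp_assoc,
        Coalgebra.rTensor_counit_comp_comul]
      convert LinearMap.id_apply (R := k) R
      convert LinearMap.lTensor_id H H
      ext; simp
    rw [h2] at h1
    have h3 : e R ⊗ₜ[k] (1 : H) = 1 := hR.isUnit.mul_left_cancel (by simpa using h1.symm)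
    have h4 := congrArg e h3
    simpa [he, Algebra.TensorProduct.one_def] using h4
  · intro a b a' b'
    simp [he]

lemma rTensor_counit_eq (hR : IsSemiquasitriangular R) :
    TensorProduct.lid k H ((counit (R := k) (A := H)).rTensor H R) = 1 := by
  set e : H ⊗[k] H →ₗ[k] H :=
    (TensorProduct.lid k H).toLinearMap ∘ₗ (counit (R := k) (A := H)).rTensor H with he
  have h1 := congrArg ((TensorProduct.lid k H).toLinearMap ∘ₗ
    (counit (R := k) (A := H)).rTensor H |>.lTensor H) hR.comul_left
  rw [apply_leg13_mul_leg23 _ ((LinearMap.mul k (H ⊗[k] H)).compl₂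
    ((inr k H).toLinearMap ∘ₗ e))] at h1
  · have h2 : ∀ T : H ⊗[k] H, ((TensorProduct.lid k H).toLinearMap ∘ₗ
        (counit (R := k) (A := H)).rTensor H |>.lTensor H) (comulLeft T) = T := by
      intro T
      induction T with
      | zero => simp [comulLeft]
      | add s t hs ht =>
        rw [comulLeft] at hs ht
        simp only [comulLeft, map_add]
        rw [hs, ht]
      | tmul a b =>
        have key : ∀ t : H ⊗[k] H, ((TensorProduct.lid k H).toLinearMap ∘ₗ
          (counit (R := k) (A := H)).rTensor H |>.lTensor H) (TensorProduct.assoc k H H H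
            (t ⊗ₜ b)) = (TensorProduct.rid k H ((counit (R := k) (A := H)).lTensor H t)) ⊗ₜ b := by
          intro t
          induction t with
          | zero => simp
          | add s t hs ht => simp only [TensorProduct.add_tmul, map_add, hs, ht]
          | tmul x y => simp [TensorProduct.smul_tmul]
        simp [comulLeft, key]
    rw [h2] at h1
    have h3 : (1 : H) ⊗ₜ[k] e R = 1 := hR.isUnit.mul_left_cancel (by simpa using h1.symm)
    have h4 := congrArg e h3
    simpa [he, Algebra.TensorProduct.one_def] using h4
  · intro a b a' b'
    simp [he]

/-- `(S ⊗ H)(R)` is the inverse of `R`. -/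
lemma mul_antipode_rTensor (hR : IsSemiquasitriangular R) :
    R * (antipode k (A := H)).rTensor H R = 1 := by
  set F : H ⊗[k] (H ⊗[k] H) →ₗ[k] H ⊗[k] H := (LinearMap.mul' k H ∘ₗ
    (antipode k (A := H)).lTensor H).rTensor H ∘ₗ (TensorProduct.assoc k H H H).symm.toLinearMap
    with hF
  have h1 := congrArg F hR.comul_left
  rw [apply_leg13_mul_leg23 _ ((LinearMap.mul k (H ⊗[k] H)).compl₂
    ((antipode k (A := H)).rTensor H))] at h1
  · simp only [LinearMap.compl₂_apply, LinearMap.mul_apply'] at h1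
    rw [← h1]
    simp only [hF, comulLeft, LinearMap.comp_apply, LinearEquiv.coe_coe,
      LinearEquiv.symm_apply_apply]
    rw [← LinearMap.comp_apply, ← LinearMap.rTensor_comp, LinearMap.comp_assoc,
      HopfAlgebra.mul_antipode_lTensor_comul]
    have h2 : ∀ T : H ⊗[k] H, (Algebra.linearMap k H ∘ₗ counit).rTensor H T =
        (1 : H) ⊗ₜ TensorProduct.lid k H ((counit (R := k) (A := H)).rTensor H T) := by
      intro T
      induction T with
      | zero => simp
      | add s t hs ht => simp only [TensorProduct.tmul_add, map_add, hs, ht]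
      | tmul x y => simp [Algebra.algebraMap_eq_smul_one, TensorProduct.smul_tmul]
    rw [h2, rTensor_counit_eq hR, Algebra.TensorProduct.one_def]
  · intro a b a' b'
    simp [hF]

lemma antipode_rTensor_mul (hR : IsSemiquasitriangular R) :
    (antipode k (A := H)).rTensor H R * R = 1 := by
  obtain ⟨U, hU⟩ := hR.isUnit
  have h := mul_antipode_rTensor hR
  rw [← hU] at h ⊢
  rw [Units.mul_eq_one_iff_inv_eq] at h
  rw [← h, Units.inv_mul]

/-- In legs, `R⁽¹⁾ R'⁽¹⁾ ⊗ S(R'⁽²⁾) R⁽²⁾ = 1`. -/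
lemma comulRight_antipode (hR : IsSemiquasitriangular R) :
    (LinearMap.mul' k H ∘ₗ (antipode k (A := H)).rTensor H).lTensor H (leg13 R * leg12 R) = 1 := by
  rw [← hR.comul_right, comulRight, ← LinearMap.comp_apply, ← LinearMap.lTensor_comp,
    LinearMap.comp_assoc, HopfAlgebra.mul_antipode_rTensor_comul]
  have h2 : ∀ T : H ⊗[k] H, (Algebra.linearMap k H ∘ₗ counit).lTensor H T =
      TensorProduct.rid k H ((counit (R := k) (A := H)).lTensor H T) ⊗ₜ (1 : H) := by
    intro T
    induction T with
    | zero => simp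
    | add s t hs ht => simp only [TensorProduct.add_tmul, map_add, hs, ht]
    | tmul x y => simp [Algebra.algebraMap_eq_smul_one, TensorProduct.smul_tmul]
  rw [h2, lTensor_counit_eq hR, Algebra.TensorProduct.one_def]

/-- `R` is invariant under `S ⊗ S`. -/
lemma antipode_map_eq (hR : IsSemiquasitriangular R) :
    TensorProduct.map (antipode k) (antipode k) R = R := by
  have h1 := congrArg ((antipode k (A := H)).rTensor H) (comulRight_antipode hR)
  rw [← LinearMap.comp_apply, apply_leg13_mul_leg12 _ ((LinearMap.mul k (H ⊗[k] H)).flip.compl₁₂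
    ((antipode k (A := H)).rTensor H) (TensorProduct.map (antipode k) (antipode k)))] at h1
  · simp only [LinearMap.compl₁₂_apply, LinearMap.flip_apply, LinearMap.mul_apply',
      Algebra.TensorProduct.one_def, LinearMap.rTensor_tmul, antipode_one] at h1
    rw [← Algebra.TensorProduct.one_def] at h1
    exact left_inv_eq_right_inv h1 (antipode_rTensor_mul hR)
  · intro a b a' b'
    simp [antipode_mul_antidistrib]

end Universal

/-! ### The map `nu` -/

section Nu

variable {k : Type u} [Field k] {H : Type v} [Ring H] [HopfAlgebra k H] {R : H ⊗[k] H}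

@[simp] lemma flip_tmul (a b : H) : flip (a ⊗ₜ[k] b) = b ⊗ₜ a := rfl
@[simp] lemma flip_add (s t : H ⊗[k] H) : flip (s + t) = flip s + flip t := map_add _ _ _
@[simp] lemma flip_zero : flip (0 : H ⊗[k] H) = 0 := map_zero _

lemma flip_mul (s t : H ⊗[k] H) : flip (s * t) = flip s * flip t :=
  map_mul (Algebra.TensorProduct.comm k H H) s t

lemma flip_one : flip (1 : H ⊗[k] H) = 1 := rfl

lemma flipAntipode_mul_flip (hR : IsSemiquasitriangular R) : flipAntipode R * flip R = 1 := by
  rw [flipAntipode, ← flip_mul, antipode_rTensor_mul hR, flip_one]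

lemma flip_mul_flipAntipode (hR : IsSemiquasitriangular R) : flip R * flipAntipode R = 1 := by
  rw [flipAntipode, ← flip_mul, mul_antipode_rTensor hR, flip_one]

/-- The comultiplication conjugated by `flip R`, whose inverse is `flipAntipode R` for a
semiquasitriangular `R`. -/
def conjComul (R : H ⊗[k] H) : H →ₗ[k] H ⊗[k] H :=
  LinearMap.mulLeft k (flipAntipode R) ∘ₗ LinearMap.mulRight k (flip R) ∘ₗ comul

lemma conjComul_apply (R : H ⊗[k] H) (h : H) :
    conjComul R h = flipAntipode R * (comul h * flip R) := rfl

lemma conjComul_mul (hR : IsSemiquasitriangular R) (x y : H) :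
    conjComul R (x * y) = conjComul R x * conjComul R y := by
  simp only [conjComul_apply, Bialgebra.comul_mul]
  have h := flip_mul_flipAntipode hR
  calc _ = flipAntipode R * (comul x * (1 * (comul y * flip R))) := by
        rw [one_mul, mul_assoc]
    _ = _ := by rw [← h]; simp only [mul_assoc]

lemma nu_eq_twist (R : H ⊗[k] H) : nu R = twist (conjComul R) := antipodeTwist_eq _

lemma conv_inr_nu (R : H ⊗[k] H) : conv (inr k H).toLinearMap (nu R) = conjComul R := by
  rw [nu_eq_twist, conv_inr_twist]

lemma mul_inr_comm_of_mem_tensorCenter {t : H ⊗[k] H} (ht : t ∈ tensorCenter k H H) (y : H) :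
    t * inr k H y = inr k H y * t := by
  obtain ⟨s, rfl⟩ := ht
  induction s with
  | zero => simp
  | add s t hs ht => simp only [map_add, add_mul, mul_add, hs, ht]
  | tmul x z => simp [(Subalgebra.mem_center_iff.1 z.2 y)]

lemma nu_mul_inr (hR : IsSemiquasitriangular R) (h y : H) :
    nu R h * inr k H y = inr k H y * nu R h :=
  mul_inr_comm_of_mem_tensorCenter (hR.nu_mem h) y

lemma nu_mul (hR : IsSemiquasitriangular R) (x y : H) : nu R (x * y) = nu R x * nu R y := by
  have key : ∀ s t : H ⊗[k] H,
      LinearMap.mul' k (H ⊗[k] H)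
        (TensorProduct.map ((inr k H).toLinearMap ∘ₗ antipode k) (conjComul R) (s * t)) =
      LinearMap.mul' k (H ⊗[k] H) (TensorProduct.map ((inr k H).toLinearMap ∘ₗ antipode k)
        (LinearMap.mulLeft k (LinearMap.mul' k (H ⊗[k] H)
          (TensorProduct.map ((inr k H).toLinearMap ∘ₗ antipode k) (conjComul R) s)) ∘ₗ
            conjComul R) t) := by
    intro s t
    induction t with
    | zero => simp
    | add t t' ht ht' => simp only [mul_add, map_add, ht, ht']
    | tmul c d =>
    induction s with
    | zero => simp
    | add t t' ht ht' =>
      simp only [add_mul, map_add, ht, ht', TensorProduct.map_tmul, LinearMap.mul'_apply,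
        LinearMap.comp_apply, LinearMap.mulLeft_apply, mul_add]
    | tmul a b =>
      simp only [Algebra.TensorProduct.tmul_mul_tmul, TensorProduct.map_tmul, LinearMap.mul'_apply,
        LinearMap.comp_apply, LinearMap.mulLeft_apply, antipode_mul_antidistrib, map_mul,
        conjComul_mul hR, AlgHom.toLinearMap_apply, mul_assoc]
  have hc : ∀ t : H ⊗[k] H, LinearMap.mul' k (H ⊗[k] H)
      (TensorProduct.map ((inr k H).toLinearMap ∘ₗ antipode k)
        (LinearMap.mulLeft k (nu R x) ∘ₗ conjComul R) t) =
      nu R x * LinearMap.mul' k (H ⊗[k] H)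
        (TensorProduct.map ((inr k H).toLinearMap ∘ₗ antipode k) (conjComul R) t) := by
    intro t
    induction t with
    | zero => simp
    | add t t' ht ht' => simp only [mul_add, map_add, ht, ht']
    | tmul c d =>
      simp only [TensorProduct.map_tmul, LinearMap.mul'_apply, LinearMap.comp_apply,
        LinearMap.mulLeft_apply, AlgHom.toLinearMap_apply, ← mul_assoc, nu_mul_inr hR]
  rw [nu_eq_twist, twist_apply, Bialgebra.comul_mul, key, ← twist_apply _ x, ← nu_eq_twist, hc,
    ← twist_apply, ← nu_eq_twist]

lemma nu_one (hR : IsSemiquasitriangular R) : nu R 1 = 1 := by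
  rw [nu_eq_twist, twist_apply, Bialgebra.comul_one, Algebra.TensorProduct.one_def,
    TensorProduct.map_tmul, LinearMap.mul'_apply, LinearMap.comp_apply, antipode_one,
    AlgHom.toLinearMap_apply, map_one, one_mul, conjComul_apply, Bialgebra.comul_one, one_mul,
    flipAntipode_mul_flip hR, Algebra.TensorProduct.one_def]

lemma lTensor_mulRight {B C : Type*} [Ring B] [Algebra k B] [Ring C] [Algebra k C]
    (b : B) (t : C ⊗[k] B) : (LinearMap.mulRight k b).lTensor C t = t * (1 ⊗ₜ b) := by
  induction t with
  | zero => simp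
  | add s t hs ht => simp only [map_add, hs, ht, add_mul]
  | tmul x y => simp

lemma lTensor_mulLeft {B C : Type*} [Ring B] [Algebra k B] [Ring C] [Algebra k C]
    (b : B) (t : C ⊗[k] B) : (LinearMap.mulLeft k b).lTensor C t = (1 ⊗ₜ b) * t := by
  induction t with
  | zero => simp
  | add s t hs ht => simp only [map_add, hs, ht, mul_add]
  | tmul x y => simp

lemma assoc_rTensor_mulRight (b : H ⊗[k] H) (t : (H ⊗[k] H) ⊗[k] H) :
    TensorProduct.assoc k H H H ((LinearMap.mulRight k b).rTensor H t) =
      TensorProduct.assoc k H H H t * leg12 b := by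
  induction t with
  | zero => simp
  | add s t hs ht => simp only [map_add, hs, ht, add_mul]
  | tmul x y =>
    rw [LinearMap.rTensor_tmul, LinearMap.mulRight_apply]
    induction b with
    | zero => simp
    | add s t hs ht => simp only [mul_add, leg12_add, map_add, hs, ht, TensorProduct.add_tmul]
    | tmul p q =>
    induction x with
    | zero => simp
    | add s t hs ht => simp only [add_mul, map_add, hs, ht, TensorProduct.add_tmul]
    | tmul x x' => simp

lemma assoc_rTensor_mulLeft (b : H ⊗[k] H) (t : (H ⊗[k] H) ⊗[k] H) :
    TensorProduct.assoc k H H H ((LinearMap.mulLeft k b).rTensor H t) =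
      leg12 b * TensorProduct.assoc k H H H t := by
  induction t with
  | zero => simp
  | add s t hs ht => simp only [map_add, hs, ht, mul_add]
  | tmul x y =>
    rw [LinearMap.rTensor_tmul, LinearMap.mulLeft_apply]
    induction b with
    | zero => simp
    | add s t hs ht => simp only [add_mul, leg12_add, map_add, hs, ht, TensorProduct.add_tmul]
    | tmul p q =>
    induction x with
    | zero => simp
    | add s t hs ht => simp only [mul_add, map_add, hs, ht, TensorProduct.add_tmul]
    | tmul x x' => simp

/-- Whether two maps agree on the second leg of `R` is not affected by `twist`. -/
lemma lTensor_twist_congr (hR : IsSemiquasitriangular R) {G G' : H →ₗ[k] H ⊗[k] H}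
    (h : G.lTensor H R = G'.lTensor H R) : (twist G).lTensor H R = (twist G').lTensor H R := by
  have key : ∀ G : H →ₗ[k] H ⊗[k] H, (twist G).lTensor H R =
      TensorProduct.homTensorHomMap (RingHom.id k) H (H ⊗[k] H) H (H ⊗[k] H)
        (TensorProduct.map (LinearMap.mul k H).flip
          (LinearMap.mul k (H ⊗[k] H) ∘ₗ (inr k H).toLinearMap ∘ₗ antipode k) R)
        (G.lTensor H R) := by
    intro G
    have e : (twist G).lTensor H R =
        (LinearMap.mul' k (H ⊗[k] H) ∘ₗ
          TensorProduct.map ((inr k H).toLinearMap ∘ₗ antipode k) G).lTensor H (comulRight R) := by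
      rw [comulRight, ← LinearMap.comp_apply, ← LinearMap.lTensor_comp]
      rfl
    rw [e, hR.comul_right]
    rw [apply_leg13_mul_leg12 _ ((TensorProduct.homTensorHomMap (RingHom.id k) H (H ⊗[k] H) H
      (H ⊗[k] H) ∘ₗ TensorProduct.map (LinearMap.mul k H).flip
          (LinearMap.mul k (H ⊗[k] H) ∘ₗ (inr k H).toLinearMap ∘ₗ antipode k)).flip ∘ₗ
            G.lTensor H)]
    · rfl
    · intro a b a' b'
      simp
  rw [key, key, h]

/-- Whether two maps agree on the first leg of `R` is not affected by `twist`. -/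
lemma rTensor_twist_congr (hR : IsSemiquasitriangular R) {G G' : H →ₗ[k] H ⊗[k] H}
    (h : G.rTensor H R = G'.rTensor H R) : (twist G).rTensor H R = (twist G').rTensor H R := by
  have key : ∀ G : H →ₗ[k] H ⊗[k] H, (twist G).rTensor H R =
      TensorProduct.homTensorHomMap (RingHom.id k) (H ⊗[k] H) H (H ⊗[k] H) H
        (TensorProduct.map
          (LinearMap.mul k (H ⊗[k] H) ∘ₗ (inr k H).toLinearMap ∘ₗ antipode k)
          (LinearMap.mul k H) R)
        (G.rTensor H R) := by
    intro G
    have e : (twist G).rTensor H R =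
        ((LinearMap.mul' k (H ⊗[k] H) ∘ₗ
          TensorProduct.map ((inr k H).toLinearMap ∘ₗ antipode k) G).rTensor H ∘ₗ
            (TensorProduct.assoc k H H H).symm.toLinearMap) (comulLeft R) := by
      rw [comulLeft, LinearMap.comp_apply, LinearEquiv.coe_coe, LinearEquiv.symm_apply_apply,
        ← LinearMap.comp_apply, ← LinearMap.rTensor_comp]
      rfl
    rw [e, hR.comul_left]
    rw [apply_leg13_mul_leg23 _ ((TensorProduct.homTensorHomMap (RingHom.id k) (H ⊗[k] H) H
      (H ⊗[k] H) H ∘ₗ TensorProduct.map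
          (LinearMap.mul k (H ⊗[k] H) ∘ₗ (inr k H).toLinearMap ∘ₗ antipode k)
          (LinearMap.mul k H)).compl₂ (G.rTensor H))]
    · rfl
    · intro a b a' b'
      simp
  rw [key, key, h]

lemma sandwich_inl_mul (T : H ⊗[k] H) (x : H) (t : H ⊗[k] H) :
    sandwich T (inl k H x * t) = inl k H x * sandwich T t := by
  induction t with
  | zero => simp
  | add s t hs ht => simp only [mul_add, map_add, hs, ht]
  | tmul y z =>
  rw [sandwich]
  induction T with
  | zero => simp
  | add s t hs ht => simp only [mul_add, map_add, LinearMap.add_apply, hs, ht]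
  | tmul p q => simp [mul_assoc]

lemma sandwich_self (hR : IsSemiquasitriangular R) : sandwich R R = 1 := by
  have h := comulRight_antipode hR
  rwa [apply_leg13_mul_leg12 _ (TensorProduct.homTensorHomMap (RingHom.id k) H H H H ∘ₗ
    (TensorProduct.map (LinearMap.mul k H).flip (LinearMap.mul k H ∘ₗ antipode k))).flip] at h
  intro a b a' b'
  simp

/-- The map `nu` is trivial on the second leg of `R`. -/
lemma lTensor_nu (hR : IsSemiquasitriangular R) :
    (nu R).lTensor H R = (inl k H).toLinearMap.lTensor H R := by
  have h1 : (LinearMap.mulLeft k R ∘ₗ comul).lTensor H R =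
      (LinearMap.mulRight k R ∘ₗ comulOp k H).lTensor H R := by
    rw [LinearMap.lTensor_comp, LinearMap.lTensor_comp, LinearMap.comp_apply, LinearMap.comp_apply,
      lTensor_mulLeft, lTensor_mulRight]
    exact hR.comul_right_comm.symm
  have h2 : nu R = sandwich R ∘ₗ twist (LinearMap.mulLeft k R ∘ₗ comul) := by
    rw [← antipodeTwist_eq]
    exact LinearMap.ext hR.nu_eq
  have h3 : sandwich R ∘ₗ LinearMap.mulRight k R ∘ₗ (inl k H).toLinearMap =
      (inl k H).toLinearMap := by
    ext x
    simp only [LinearMap.comp_apply, AlgHom.toLinearMap_apply, LinearMap.mulRight_apply]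
    rw [sandwich_inl_mul, sandwich_self hR, mul_one]
  rw [h2, LinearMap.lTensor_comp, LinearMap.comp_apply, lTensor_twist_congr hR h1, twist_mulRight,
    twist_comulOp, ← LinearMap.comp_apply, ← LinearMap.lTensor_comp, h3]

/-- The map `nu` is trivial on the first leg of `R`. -/
lemma rTensor_nu (hR : IsSemiquasitriangular R) :
    (nu R).rTensor H R = (inl k H).toLinearMap.rTensor H R := by
  have h1 : (LinearMap.mulRight k R ∘ₗ comulOp k H).rTensor H R =
      (LinearMap.mulLeft k R ∘ₗ comul).rTensor H R := by
    apply (TensorProduct.assoc k H H H).injective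
    rw [LinearMap.rTensor_comp, LinearMap.rTensor_comp, LinearMap.comp_apply, LinearMap.comp_apply,
      assoc_rTensor_mulLeft, assoc_rTensor_mulRight]
    exact hR.comul_left_comm
  have h2 : (LinearMap.mulLeft k (flipAntipode R) ∘ₗ (TensorProduct.comm k H H).toLinearMap) ∘ₗ
      (LinearMap.mulRight k R ∘ₗ comulOp k H) = conjComul R := by
    ext x
    change flipAntipode R * flip (comulOp k H x * R) = _
    rw [flip_mul, conjComul_apply]
    congr 2
    exact (TensorProduct.comm k H H).symm_apply_apply _
  have h3 : (LinearMap.mulLeft k (flipAntipode R) ∘ₗ (TensorProduct.comm k H H).toLinearMap) ∘ₗ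
      (LinearMap.mulLeft k R ∘ₗ comul) = comulOp k H := by
    ext x
    change flipAntipode R * flip (R * comul x) = _
    rw [flip_mul, ← mul_assoc, flipAntipode_mul_flip hR, one_mul]
    rfl
  have h4 : (conjComul R).rTensor H R = (comulOp k H).rTensor H R := by
    refine (congrArg (fun f => f.rTensor H R) h2).symm.trans
      (Eq.trans ?_ (congrArg (fun f => f.rTensor H R) h3))
    simp only [LinearMap.rTensor_comp_apply] at h1 ⊢
    rw [h1]
  rw [nu_eq_twist, rTensor_twist_congr hR h4, twist_comulOp]

lemma map_nu_nu (hR : IsSemiquasitriangular R) :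
    TensorProduct.map (nu R) (nu R) R =
      TensorProduct.map (inl k H).toLinearMap (inl k H).toLinearMap R := by
  rw [← LinearMap.rTensor_comp_lTensor, LinearMap.comp_apply, lTensor_nu hR,
    ← LinearMap.comp_apply, LinearMap.rTensor_comp_lTensor, ← LinearMap.lTensor_comp_rTensor,
    LinearMap.comp_apply, rTensor_nu hR, ← LinearMap.comp_apply, LinearMap.lTensor_comp_rTensor]

end Nu

/-! ### `nu` and the antipode -/

section Theta

variable {k : Type u} [Field k] {H : Type v} [Ring H] [HopfAlgebra k H] {R : H ⊗[k] H}

/-- `x ⊗ z ↦ ν(S(x)) (1 ⊗ S(z))`. -/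
def nuAntipode (R : H ⊗[k] H) : H ⊗[k] H →ₗ[k] H ⊗[k] H :=
  LinearMap.mul' k (H ⊗[k] H) ∘ₗ
    TensorProduct.map (nu R ∘ₗ antipode k) ((inr k H).toLinearMap ∘ₗ antipode k)

lemma nuAntipode_tmul (x z : H) :
    nuAntipode R (x ⊗ₜ z) = nu R (antipode k x) * inr k H (antipode k z) := by
  simp [nuAntipode]

lemma nuAntipode_mul (hR : IsSemiquasitriangular R) (s t : H ⊗[k] H) :
    nuAntipode R (s * t) = nuAntipode R t * nuAntipode R s := by
  induction s with
  | zero => simp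
  | add s t hs ht => simp only [add_mul, mul_add, map_add, hs, ht]
  | tmul x z =>
  induction t with
  | zero => simp
  | add s t hs ht => simp only [add_mul, mul_add, map_add, hs, ht]
  | tmul x' z' =>
    simp only [Algebra.TensorProduct.tmul_mul_tmul, nuAntipode_tmul, antipode_mul_antidistrib,
      nu_mul hR, map_mul, mul_assoc]
    rw [← mul_assoc (nu R (antipode k x)), nu_mul_inr hR, mul_assoc]

lemma nuAntipode_inr (hR : IsSemiquasitriangular R) (z : H) :
    nuAntipode R (inr k H z) = inr k H (antipode k z) := by
  rw [inr_apply, nuAntipode_tmul, antipode_one, nu_one hR, one_mul]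

lemma nuAntipode_flip (hR : IsSemiquasitriangular R) : nuAntipode R (flip R) = flip R := by
  have h1 : ∀ T : H ⊗[k] H, nuAntipode R (flip T) = LinearMap.mul' k (H ⊗[k] H)
      (TensorProduct.comm k _ _ (((inr k H).toLinearMap).rTensor (H ⊗[k] H)
        ((nu R).lTensor H (TensorProduct.map (antipode k) (antipode k) T)))) := by
    intro T
    induction T with
    | zero => simp
    | add s t hs ht => simp only [flip_add, map_add, hs, ht]
    | tmul x y => simp [nuAntipode_tmul]
  rw [h1, antipode_map_eq hR, lTensor_nu hR]
  have h2 : ∀ T : H ⊗[k] H, LinearMap.mul' k (H ⊗[k] H)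
      (TensorProduct.comm k _ _ (((inr k H).toLinearMap).rTensor (H ⊗[k] H)
        ((inl k H).toLinearMap.lTensor H T))) = flip T := by
    intro T
    induction T with
    | zero => simp
    | add s t hs ht => simp only [flip_add, map_add, hs, ht]
    | tmul x y => simp
  exact h2 R

lemma nuAntipode_flipAntipode (hR : IsSemiquasitriangular R) :
    nuAntipode R (flipAntipode R) = flipAntipode R := by
  have h := congrArg (nuAntipode R) (flipAntipode_mul_flip hR)
  have h1 : nuAntipode R 1 = 1 := by
    simpa [← Algebra.TensorProduct.one_def, antipode_one] using nuAntipode_inr hR (1 : H)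
  rw [nuAntipode_mul hR, nuAntipode_flip hR, h1] at h
  exact (left_inv_eq_right_inv (flipAntipode_mul_flip hR) h).symm

lemma nuAntipode_comul (hR : IsSemiquasitriangular R) (h : H) :
    nuAntipode R (comul h) = conjComul R (antipode k h) := by
  rw [← conv_inr_nu, conv_apply, comul_antipode, comulOp, LinearMap.comp_apply]
  generalize comul (R := k) h = t
  induction t with
  | zero => simp
  | add s t hs ht => simp only [map_add, hs, ht]
  | tmul x y =>
    rw [nuAntipode_tmul, nu_mul_inr hR]
    simp

/-- `ν(S(x)) (1 ⊗ S(z)) = S(h) ⊗ 1` for `x ⊗ z = ν(h)`. -/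
lemma nuAntipode_nu (hR : IsSemiquasitriangular R) (h : H) :
    nuAntipode R (nu R h) = inl k H (antipode k h) := by
  have h1 : nuAntipode R ∘ₗ conjComul R =
      TensorProduct.map (antipode k) (antipode k) ∘ₗ comulOp k H := by
    ext x
    rw [LinearMap.comp_apply, conjComul_apply, nuAntipode_mul hR, nuAntipode_mul hR,
      nuAntipode_comul hR, nuAntipode_flip hR, nuAntipode_flipAntipode hR, conjComul_apply,
      LinearMap.comp_apply, ← comul_antipode]
    rw [← mul_assoc (flip R), flip_mul_flipAntipode hR, one_mul, mul_assoc,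
      flip_mul_flipAntipode hR, mul_one]
  have h2 : ∀ G : H →ₗ[k] H ⊗[k] H, ∀ t : H ⊗[k] H, nuAntipode R (LinearMap.mul' k (H ⊗[k] H)
      (TensorProduct.map ((inr k H).toLinearMap ∘ₗ antipode k) G t)) =
      LinearMap.mul' k (H ⊗[k] H) (TensorProduct.comm k _ _ (TensorProduct.map
        ((inr k H).toLinearMap ∘ₗ antipode k ∘ₗ antipode k) (nuAntipode R ∘ₗ G) t)) := by
    intro G t
    induction t with
    | zero => simp
    | add s t hs ht => simp only [map_add, hs, ht]
    | tmul x y =>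
      simp only [TensorProduct.map_tmul, LinearMap.mul'_apply, TensorProduct.comm_tmul,
        LinearMap.comp_apply, AlgHom.toLinearMap_apply, nuAntipode_mul hR, nuAntipode_inr hR]
  -- The conjugations have cancelled, and pulling out `S ⊗ S` leaves `twist_comulOp`.
  have h3 : ∀ t : H ⊗[k] H, LinearMap.mul' k (H ⊗[k] H) (TensorProduct.comm k _ _
      (TensorProduct.map ((inr k H).toLinearMap ∘ₗ antipode k ∘ₗ antipode k)
        (TensorProduct.map (antipode k) (antipode k) ∘ₗ comulOp k H) t)) =
      TensorProduct.map (antipode k) (antipode k) (LinearMap.mul' k (H ⊗[k] H)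
        (TensorProduct.map ((inr k H).toLinearMap ∘ₗ antipode k) (comulOp k H) t)) := by
    intro t
    induction t with
    | zero => simp
    | add s t hs ht => simp only [map_add, hs, ht]
    | tmul x y =>
      simp only [TensorProduct.map_tmul, LinearMap.mul'_apply, TensorProduct.comm_tmul,
        LinearMap.comp_apply, AlgHom.toLinearMap_apply]
      generalize comulOp k H y = w
      induction w with
      | zero => simp
      | add s t hs ht => simp only [map_add, add_mul, mul_add, hs, ht]
      | tmul p q => simp [antipode_mul_antidistrib]
  rw [nu_eq_twist, twist_apply, h2, h1, h3, ← twist_apply, twist_comulOp]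
  simp [antipode_one]

end Theta

/-! ### `nu` and the comultiplication -/

section NuComul

variable {k : Type u} [Field k] {H : Type v} [Ring H] [HopfAlgebra k H] {R : H ⊗[k] H}

variable (k H) in
/-- `x ⊗ z ↦ x ⊗ 1 ⊗ z`. -/
def emb13 : H ⊗[k] H →ₐ[k] (H ⊗[k] H) ⊗[k] H :=
  Algebra.TensorProduct.map (inl k H) (AlgHom.id k H)

variable (k H) in
/-- `x ⊗ z ↦ 1 ⊗ x ⊗ z`. -/
def emb23 : H ⊗[k] H →ₐ[k] (H ⊗[k] H) ⊗[k] H :=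
  Algebra.TensorProduct.map (inr k H) (AlgHom.id k H)

variable (k H) in
/-- `x ⊗ z ↦ Δ(x) ⊗ z`. -/
def comulFst : H ⊗[k] H →ₐ[k] (H ⊗[k] H) ⊗[k] H :=
  Algebra.TensorProduct.map (Bialgebra.comulAlgHom k H) (AlgHom.id k H)

@[simp] lemma emb13_tmul (x z : H) : emb13 k H (x ⊗ₜ z) = (x ⊗ₜ 1) ⊗ₜ z := rfl
@[simp] lemma emb23_tmul (x z : H) : emb23 k H (x ⊗ₜ z) = (1 ⊗ₜ x) ⊗ₜ z := rfl
@[simp] lemma comulFst_tmul (x z : H) : comulFst k H (x ⊗ₜ z) = comul x ⊗ₜ z := rfl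

lemma comulFst_flip (hR : IsSemiquasitriangular R) :
    comulFst k H (flip R) = emb23 k H (flip R) * emb13 k H (flip R) := by
  have h := congrArg (TensorProduct.comm k H (H ⊗[k] H)).toLinearMap hR.comul_right
  rw [apply_leg13_mul_leg12 _ ((LinearMap.mul k ((H ⊗[k] H) ⊗[k] H)).compl₁₂
    ((emb23 k H).toLinearMap ∘ₗ (TensorProduct.comm k H H).toLinearMap)
    ((emb13 k H).toLinearMap ∘ₗ (TensorProduct.comm k H H).toLinearMap))] at h
  · refine Eq.trans ?_ h
    have : ∀ T : H ⊗[k] H, comulFst k H (flip T) =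
        (TensorProduct.comm k H (H ⊗[k] H)) ((comul (R := k) (A := H)).lTensor H T) := by
      intro T
      induction T with
      | zero => simp
      | add s t hs ht => simp only [flip_add, map_add, hs, ht]
      | tmul x y => simp
    exact this R
  · intro a b a' b'
    simp

lemma comulFst_flipAntipode (hR : IsSemiquasitriangular R) :
    comulFst k H (flipAntipode R) = emb13 k H (flipAntipode R) * emb23 k H (flipAntipode R) := by
  refine left_inv_eq_right_inv (a := comulFst k H (flip R)) ?_ ?_
  · rw [← map_mul, flipAntipode_mul_flip hR, map_one]
  · rw [comulFst_flip hR, mul_assoc, ← mul_assoc (emb13 k H _), ← map_mul,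
      flip_mul_flipAntipode hR, map_one, one_mul, ← map_mul, flip_mul_flipAntipode hR, map_one]

lemma emb13_mul_emb23_of_mem_tensorCenter {t : H ⊗[k] H} (ht : t ∈ tensorCenter k H H)
    (s : H ⊗[k] H) : emb13 k H s * emb23 k H t = emb23 k H t * emb13 k H s := by
  obtain ⟨t, rfl⟩ := ht
  induction t with
  | zero => simp
  | add t t' ht ht' => simp only [map_add, add_mul, mul_add, ht, ht']
  | tmul x z =>
  induction s with
  | zero => simp
  | add t t' ht ht' => simp only [map_add, add_mul, mul_add, ht, ht']
  | tmul y w => simp [(Subalgebra.mem_center_iff.1 z.2 w)]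

/-- `(Δ ⊗ H) ν(h)` is the product of `ν(h₁)` in legs `1, 3` and `ν(h₂)` in legs `2, 3`. Both sides
are convolution products whose left factor is `h ↦ 1 ⊗ 1 ⊗ S(h)`. -/
lemma comulFst_nu (hR : IsSemiquasitriangular R) (h : H) :
    comulFst k H (nu R h) = mulLegs H H H (TensorProduct.map (nu R) (nu R) (comul h)) := by
  set j : H →ₐ[k] (H ⊗[k] H) ⊗[k] H := Algebra.TensorProduct.includeRight with hj
  set i₁ := (emb13 k H).comp (inl k H)
  set i₂ := (emb23 k H).comp (inl k H)
  have hj1 : (comulFst k H).comp (inr k H) = j := by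
    ext x; simp [hj]
  have hj2 : (emb13 k H).comp (inr k H) = j := by
    ext x; simp [hj, ← Algebra.TensorProduct.one_def]
  have hj3 : (emb23 k H).comp (inr k H) = j := by
    ext x; simp [hj, ← Algebra.TensorProduct.one_def]
  have hi : (comulFst k H).toLinearMap ∘ₗ (inl k H).toLinearMap =
      conv i₁.toLinearMap i₂.toLinearMap := by
    set e : H ⊗[k] H →ₐ[k] (H ⊗[k] H) ⊗[k] H := Algebra.TensorProduct.includeLeft
    have h1 : e.comp (inl k H) = i₁ := by ext x; rfl
    have h2 : e.comp (inr k H) = i₂ := by ext x; rfl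
    have h3 := algHom_comp_conv e (inl k H).toLinearMap (inr k H).toLinearMap
    rw [conv_inl_inr, ← AlgHom.comp_toLinearMap, ← AlgHom.comp_toLinearMap, h1, h2] at h3
    rw [← h3]
    ext x
    rfl
  have hconj : ∀ φ : H ⊗[k] H →ₐ[k] (H ⊗[k] H) ⊗[k] H, φ.toLinearMap ∘ₗ conjComul R =
      LinearMap.mulLeft k (φ (flipAntipode R)) ∘ₗ LinearMap.mulRight k (φ (flip R)) ∘ₗ
        φ.toLinearMap ∘ₗ comul := by
    intro φ
    ext x
    simp [conjComul_apply]
  have hnu : ∀ φ : H ⊗[k] H →ₐ[k] (H ⊗[k] H) ⊗[k] H, φ.comp (inr k H) = j →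
      φ.toLinearMap ∘ₗ nu R = conv (j.toLinearMap ∘ₗ antipode k)
        (LinearMap.mulLeft k (φ (flipAntipode R)) ∘ₗ LinearMap.mulRight k (φ (flip R)) ∘ₗ
        φ.toLinearMap ∘ₗ comul) := by
    intro φ hφ
    rw [nu_eq_twist, twist, algHom_comp_conv, hconj, ← hφ]
    rfl
  have hleft : (comulFst k H).toLinearMap ∘ₗ comul =
      conv i₁.toLinearMap ((emb23 k H).toLinearMap ∘ₗ comul) := by
    rw [← conv_inl_inr, algHom_comp_conv, algHom_comp_conv, hi, ← AlgHom.comp_toLinearMap,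
      ← AlgHom.comp_toLinearMap, ← AlgHom.comp_toLinearMap, hj1, hj3, conv_assoc]
  have hright : conv ((emb13 k H).toLinearMap ∘ₗ comul) ((emb23 k H).toLinearMap ∘ₗ nu R) =
      LinearMap.mulLeft k (emb23 k H (flipAntipode R)) ∘ₗ
      LinearMap.mulRight k (emb23 k H (flip R)) ∘ₗ (comulFst k H).toLinearMap ∘ₗ comul := by
    have h1 : conv j.toLinearMap ((emb23 k H).toLinearMap ∘ₗ nu R) =
        (emb23 k H).toLinearMap ∘ₗ conjComul R := by
      rw [← conv_inr_nu, algHom_comp_conv, ← AlgHom.comp_toLinearMap, hj3]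
    rw [← conv_inl_inr, algHom_comp_conv, ← AlgHom.comp_toLinearMap,
      ← AlgHom.comp_toLinearMap, hj2, conv_assoc, h1, hconj, conv_mulLeft_comm, conv_mulRight]
    · rw [conv_inl_inr, hleft]
    · intro x
      generalize flipAntipode R = t
      induction t with
      | zero => simp
      | add s t hs ht => simp only [map_add, mul_add, add_mul, hs, ht]
      | tmul y z => simp
  have hmain : (comulFst k H).toLinearMap ∘ₗ nu R =
      conv ((emb13 k H).toLinearMap ∘ₗ nu R) ((emb23 k H).toLinearMap ∘ₗ nu R) := by
    rw [hnu _ hj1, hnu _ hj2, conv_assoc, conv_mulLeft, conv_mulRight_comm, hright,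
      comulFst_flip hR, comulFst_flipAntipode hR]
    · congr 1
      ext x
      simp [mul_assoc]
    · intro x
      exact emb13_mul_emb23_of_mem_tensorCenter (hR.nu_mem x) _
  refine (congr($hmain h)).trans ?_
  rw [conv_apply]
  generalize comul (R := k) h = t
  induction t with
  | zero => simp
  | add s t hs ht => simp only [map_add, hs, ht]
  | tmul x y =>
    simp only [TensorProduct.map_tmul, LinearMap.mul'_apply, LinearMap.comp_apply,
      AlgHom.toLinearMap_apply]
    generalize nu R x = s
    generalize nu R y = t
    induction s with
    | zero => simp
    | add s t hs ht => simp only [TensorProduct.add_tmul, map_add, add_mul, hs, ht]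
    | tmul a b =>
    induction t with
    | zero => simp
    | add s t hs ht => simp only [TensorProduct.tmul_add, map_add, mul_add, hs, ht]
    | tmul a' b' => simp

end NuComul

namespace ActCoact

/-! ### The action of `H ⊗ H` on tensor products, and the subspace `M ⊗ Z(H)` -/

section Basic

variable {k : Type u} [Field k] {H : Type v} [Ring H] [HopfAlgebra k H] {R : H ⊗[k] H}

/-- The action of `H ⊗ H` on `V ⊗ H` for a representation of `H` on `V`; `actOn` is the case of an
object of `ActCoact`. It is needed where `V` is a tensor product or a dual space. -/
def actOnOf {V : Type*} [AddCommGroup V] [Module k V] (ρ : H →ₐ[k] Module.End k V) :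
    H ⊗[k] H →ₗ[k] Module.End k (V ⊗[k] H) :=
  TensorProduct.homTensorHomMap (RingHom.id k) V H V H ∘ₗ
    TensorProduct.map ρ.toLinearMap (LinearMap.mul k H)

@[simp] lemma actOnOf_tmul {V : Type*} [AddCommGroup V] [Module k V]
    (ρ : H →ₐ[k] Module.End k V) (x y h : H) (m : V) :
    actOnOf ρ (x ⊗ₜ y) (m ⊗ₜ h) = ρ x m ⊗ₜ (y * h) := by
  simp [actOnOf]

@[simp] lemma actOn_tmul (M : ActCoact k H) (x y h : H) (m : M) :
    M.actOn (x ⊗ₜ y) (m ⊗ₜ h) = M.act x m ⊗ₜ (y * h) := by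
  simp [actOn]

lemma actOn_mul (M : ActCoact k H) (s t : H ⊗[k] H) (X : M ⊗[k] H) :
    M.actOn (s * t) X = M.actOn s (M.actOn t X) := by
  induction s with
  | zero => simp
  | add s t hs ht => simp only [add_mul, map_add, LinearMap.add_apply, hs, ht]
  | tmul x y =>
  induction t with
  | zero => simp
  | add s t hs ht => simp only [mul_add, map_add, LinearMap.add_apply, hs, ht]
  | tmul x' y' =>
  induction X with
  | zero => simp
  | add s t hs ht => simp only [map_add, hs, ht]
  | tmul m h => simp [mul_assoc]

lemma actOn_one (M : ActCoact k H) (X : M ⊗[k] H) : M.actOn 1 X = X := by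
  rw [Algebra.TensorProduct.one_def]
  induction X with
  | zero => simp
  | add s t hs ht => simp only [map_add, hs, ht]
  | tmul m h => simp

/-- The factorwise action of `H ⊗ H` on a tensor product of `H`-modules. -/
def pairAct (M N : ActCoact k H) : H ⊗[k] H →ₐ[k] Module.End k (M ⊗[k] N) :=
  (Module.endTensorEndAlgHom (R := k) (S := k) (A := k) (M := M) (N := N)).comp
    (Algebra.TensorProduct.map M.act N.act)

@[simp] lemma pairAct_tmul (M N : ActCoact k H) (x y : H) (m : M) (n : N) :
    pairAct M N (x ⊗ₜ y) (m ⊗ₜ n) = M.act x m ⊗ₜ N.act y n := by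
  simp [pairAct, Module.endTensorEndAlgHom_apply]

lemma diagAct_eq_pairAct (M N : ActCoact k H) (h : H) (t : M ⊗[k] N) :
    diagAct M.act N.act h t = pairAct M N (comul h) t := rfl

lemma lTensor_act_actOn (M N : ActCoact k H) (m : M) (s : H ⊗[k] H) (X : N ⊗[k] H) :
    (M.act.toLinearMap.flip m).lTensor N (N.actOn s X) =
      pairAct N M s ((M.act.toLinearMap.flip m).lTensor N X) := by
  induction s with
  | zero => simp
  | add s t hs ht => simp only [map_add, LinearMap.add_apply, hs, ht]
  | tmul x y =>
  induction X with
  | zero => simp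
  | add s t hs ht => simp only [map_add, hs, ht]
  | tmul n h => simp

lemma lTensor_act_actOn_inr (M N : ActCoact k H) (m : M) (h : H) {X : N ⊗[k] H}
    (hX : X ∈ tensorCenter k H N) :
    (M.act.toLinearMap.flip (M.act h m)).lTensor N X =
      (M.act.toLinearMap.flip m).lTensor N (N.actOn (inr k H h) X) := by
  obtain ⟨X, rfl⟩ := hX
  induction X with
  | zero => simp
  | add s t hs ht => simp only [map_add, hs, ht]
  | tmul n z =>
    simp [← Module.End.mul_apply, ← map_mul, Subalgebra.mem_center_iff.1 z.2 h]

/-- If the coaction of `N` takes values in `N ⊗ Z(H)`, then `n₁ ⊗ n₂` lies in `Z(H) ⊗ Z(H)` by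
coassociativity: maps on `H ⊗ H` agreeing on `Z(H) ⊗ Z(H)` agree on `n₁ ⊗ n₂`. -/
lemma lTensor_comul_congr {N : ActCoact k H} (hN : ∀ n : N, N.coact n ∈ tensorCenter k H N)
    {X : Type*} [AddCommGroup X] [Module k X] {F F' : H ⊗[k] H →ₗ[k] X}
    (hF : ∀ y ∈ Subalgebra.center k H, ∀ z ∈ Subalgebra.center k H,
      F (y ⊗ₜ z) = F' (y ⊗ₜ z)) (n : N) :
    (F ∘ₗ comul).lTensor N (N.coact n) = (F' ∘ₗ comul).lTensor N (N.coact n) := by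
  rw [LinearMap.lTensor_comp_apply, LinearMap.lTensor_comp_apply, ← N.coassoc]
  obtain ⟨s, hs⟩ := hN n
  rw [← hs]
  clear hs
  induction s with
  | zero => simp
  | add s t hs ht => simp only [map_add, hs, ht]
  | tmul n z =>
    obtain ⟨t, ht⟩ := hN n
    rw [LinearMap.lTensor_tmul, LinearMap.rTensor_tmul, ← ht]
    clear ht
    induction t with
    | zero => simp
    | add s t hs ht => simp only [TensorProduct.add_tmul, map_add, hs, ht]
    | tmul n y => simp [hF y y.2 z z.2]

lemma tmul_mem_tensorCenter (M : Type w) [AddCommGroup M] [Module k M] (m : M) {z : H}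
    (hz : z ∈ Subalgebra.center k H) : m ⊗ₜ z ∈ tensorCenter k H M :=
  ⟨m ⊗ₜ ⟨z, hz⟩, rfl⟩

end Basic

/-! ### Tensor products of normal modules -/

section Tensor

variable {k : Type u} [Field k] {H : Type v} [Ring H] [HopfAlgebra k H] {R : H ⊗[k] H}

lemma mulLegs_mem_tensorCenter {V W : Type u} [AddCommGroup V] [Module k V] [AddCommGroup W]
    [Module k W] {X : V ⊗[k] H} {Y : W ⊗[k] H} (hX : X ∈ tensorCenter k H V)
    (hY : Y ∈ tensorCenter k H W) : mulLegs V W H (X ⊗ₜ Y) ∈ tensorCenter k H (V ⊗[k] W) := by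
  obtain ⟨X, rfl⟩ := hX
  obtain ⟨Y, rfl⟩ := hY
  induction X with
  | zero => simp
  | add s t hs ht => simp only [TensorProduct.add_tmul, map_add, add_mem hs ht]
  | tmul m a =>
  induction Y with
  | zero => simp
  | add s t hs ht => simp only [TensorProduct.tmul_add, map_add, add_mem hs ht]
  | tmul n b =>
    simp only [LinearMap.lTensor_tmul, mulLegs_tmul]
    exact tmul_mem_tensorCenter _ _ (mul_mem a.2 b.2)

/-- The action of `(H ⊗ H) ⊗ H` on `(M ⊗ N) ⊗ H`, by left multiplication on the last factor. -/
def pairActOn (M N : ActCoact k H) :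
    (H ⊗[k] H) ⊗[k] H →ₗ[k] Module.End k ((M ⊗[k] N) ⊗[k] H) :=
  TensorProduct.homTensorHomMap (RingHom.id k) (M ⊗[k] N) H (M ⊗[k] N) H ∘ₗ
    TensorProduct.map (pairAct M N).toLinearMap (LinearMap.mul k H)

lemma pairActOn_tmul (M N : ActCoact k H) (s : H ⊗[k] H) (y h : H) (t : M ⊗[k] N) :
    pairActOn M N (s ⊗ₜ y) (t ⊗ₜ h) = pairAct M N s t ⊗ₜ (y * h) := by
  simp [pairActOn]

lemma pairActOn_comulFst (M N : ActCoact k H) (s : H ⊗[k] H) (X : (M ⊗[k] N) ⊗[k] H) :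
    pairActOn M N (comulFst k H s) X = actOnOf (diagAct M.act N.act) s X := by
  induction s with
  | zero => simp
  | add s t hs ht => simp only [map_add, LinearMap.add_apply, hs, ht]
  | tmul x y =>
  induction X with
  | zero => simp
  | add s t hs ht => simp only [map_add, hs, ht]
  | tmul t h =>
    rw [comulFst_tmul, pairActOn_tmul, actOnOf_tmul, diagAct_eq_pairAct]

lemma mulLegs_actOn (M N : ActCoact k H) (s t : H ⊗[k] H) {X : M ⊗[k] H}
    (hX : X ∈ tensorCenter k H M) (Y : N ⊗[k] H) :
    mulLegs M N H (M.actOn s X ⊗ₜ N.actOn t Y) =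
      pairActOn M N (mulLegs H H H (s ⊗ₜ t)) (mulLegs M N H (X ⊗ₜ Y)) := by
  obtain ⟨X, rfl⟩ := hX
  induction X with
  | zero => simp
  | add s t hs ht => simp only [TensorProduct.add_tmul, map_add, hs, ht]
  | tmul m a =>
  induction Y with
  | zero => simp
  | add s t hs ht => simp only [TensorProduct.tmul_add, map_add, hs, ht]
  | tmul n b =>
  induction s with
  | zero => simp
  | add s t hs ht => simp only [TensorProduct.add_tmul, map_add, LinearMap.add_apply, hs, ht]
  | tmul x y =>
  induction t with
  | zero => simp
  | add s t hs ht => simp only [TensorProduct.tmul_add, map_add, LinearMap.add_apply, hs, ht]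
  | tmul x' y' =>
    simp only [LinearMap.lTensor_tmul, actOn_tmul, mulLegs_tmul, pairActOn_tmul, pairAct_tmul]
    congr 1
    have h := Subalgebra.mem_center_iff.1 a.2 y'
    simp only [AlgHom.toLinearMap_apply, Subalgebra.coe_val, mul_assoc]
    rw [← mul_assoc y', h, mul_assoc]

lemma isNormal_tensor (hR : IsSemiquasitriangular R) {M N : ActCoact k H} (hM : IsNormal R M)
    (hN : IsNormal R N) : IsNormal R (tensor M N) where
  coact_mem t := by
    change M ⊗[k] N at t
    change diagCoact M.coact N.coact t ∈ tensorCenter k H (M ⊗[k] N)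
    induction t with
    | zero => simp
    | add s t hs ht => simp only [map_add, add_mem hs ht]
    | tmul m n => exact mulLegs_mem_tensorCenter (hM.coact_mem m) (hN.coact_mem n)
  coact_act h t := by
    change M ⊗[k] N at t
    change diagCoact M.coact N.coact (diagAct M.act N.act h t) =
      actOnOf (diagAct M.act N.act) _ (diagCoact M.coact N.coact t)
    rw [← pairActOn_comulFst, comulFst_nu hR]
    induction t with
    | zero => simp
    | add s t hs ht => simp only [map_add, hs, ht]
    | tmul m n =>
      rw [diagAct_tmul, diagCoact_tmul]
      generalize comul (R := k) h = t
      induction t with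
      | zero => simp
      | add s t hs ht => simp only [map_add, LinearMap.add_apply, hs, ht]
      | tmul x y =>
        simp only [TensorProduct.map_tmul, LinearMap.flip_apply, AlgHom.toLinearMap_apply,
          diagCoact_tmul, hM.coact_act, hN.coact_act]
        exact mulLegs_actOn M N _ _ (hM.coact_mem m) _

/-- Since `ε` turns `flip R` and its inverse into `1`, the action of `ν(h)` on the unit object is
that of `S(h₁) h₂ = ε(h)`. -/
lemma isNormal_unit (hR : IsSemiquasitriangular R) : IsNormal R (unit k H) where
  coact_mem c := tmul_mem_tensorCenter _ c (one_mem _)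
  coact_act h c := by
    change k at c
    set e : H ⊗[k] H →ₐ[k] H := (Algebra.TensorProduct.lid k H).toAlgHom.comp
      (Algebra.TensorProduct.map (Bialgebra.counitAlgHom k H) (AlgHom.id k H)) with he
    have h1 : ∀ s : H ⊗[k] H, actOnOf (trivialAct k H) s (c ⊗ₜ[k] (1 : H)) = c ⊗ₜ[k] e s := by
      intro s
      induction s with
      | zero => simp
      | add s t hs ht => simp only [map_add, LinearMap.add_apply, hs, ht, TensorProduct.tmul_add]
      | tmul x y =>
        rw [actOnOf_tmul]
        simp [trivialAct, he, Algebra.ofId_apply, Algebra.algebraMap_eq_smul_one,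
          TensorProduct.smul_tmul']
    have h2 : e (flip R) = 1 := by
      rw [← lTensor_counit_eq hR]
      have : ∀ T : H ⊗[k] H, e (flip T) =
          TensorProduct.rid k H ((counit (R := k) (A := H)).lTensor H T) := by
        intro T
        induction T with
        | zero => simp
        | add s t hs ht => simp only [flip_add, map_add, hs, ht]
        | tmul x y => simp [he]
      exact this R
    have h3 : e (flipAntipode R) = 1 := by
      have := congrArg e (flipAntipode_mul_flip hR)
      rwa [map_mul, h2, mul_one, map_one] at this
    have h4 : e.toLinearMap ∘ₗ conjComul R = LinearMap.id := by
      ext x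
      simp only [LinearMap.comp_apply, conjComul_apply, AlgHom.toLinearMap_apply, map_mul, h2, h3,
        one_mul, mul_one, LinearMap.id_apply]
      have := Coalgebra.rTensor_counit_comul (R := k) x
      have h5 : ∀ T : H ⊗[k] H, e T =
          TensorProduct.lid k H ((counit (R := k) (A := H)).rTensor H T) := by
        intro T
        induction T with
        | zero => simp
        | add s t hs ht => simp only [map_add, hs, ht]
        | tmul x y => simp [he]
      rw [h5, this]
      simp
    have h5 : e.comp (inr k H) = AlgHom.id k H := by ext x; simp [he]
    have h6 : e (nu R h) = algebraMap k H (counit h) := by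
      have := algHom_comp_conv e ((inr k H).toLinearMap ∘ₗ antipode k) (conjComul R)
      rw [h4, ← LinearMap.comp_assoc, ← AlgHom.comp_toLinearMap, h5] at this
      rw [nu_eq_twist]
      refine (congr($this h)).trans ?_
      exact congr($(conv_antipode_self (AlgHom.id k H)) h)
    change (trivialAct k H h c) ⊗ₜ[k] (1 : H) =
      actOnOf (trivialAct k H) (nu R h) (c ⊗ₜ[k] (1 : H))
    rw [h1, h6]
    simp [trivialAct, Algebra.ofId_apply, Algebra.algebraMap_eq_smul_one, TensorProduct.smul_tmul']

end Tensor

/-! ### The braiding -/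

section Braid

variable {k : Type u} [Field k] {H : Type v} [Ring H] [HopfAlgebra k H] {R : H ⊗[k] H}

lemma braid_eq (R : H ⊗[k] H) (M N : ActCoact k H) (m : M) (n : N) :
    braid R M N m n =
      pairAct N M (flip R) ((M.act.toLinearMap.flip m).lTensor N (N.coact n)) :=
  lTensor_act_actOn _ _ _ _ _

/-- `m ↦ R⁽²⁾ · p ⊗ R⁽¹⁾ h · m`, for `p ⊗ h` in `P ⊗ H`. -/
def braidWith (R : H ⊗[k] H) (M P : ActCoact k H) (Y : P ⊗[k] H) : M →ₗ[k] P ⊗[k] M :=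
  pairAct P M (flip R) ∘ₗ (LinearMap.lTensorHom P ∘ₗ M.act.toLinearMap.flip).flip Y

lemma braidWith_apply (R : H ⊗[k] H) (M P : ActCoact k H) (Y : P ⊗[k] H) (m : M) :
    braidWith R M P Y m =
      pairAct P M (flip R) ((M.act.toLinearMap.flip m).lTensor P Y) := rfl

lemma braid_eq_braidWith (R : H ⊗[k] H) (M P : ActCoact k H) (m : M) (p : P) :
    braid R M P m p = braidWith R M P (P.coact p) m := braid_eq _ _ _ _ _

/-- The linear map `M ⊗ N → N ⊗ M` given by `braid`. -/
def braidLin (R : H ⊗[k] H) (M N : ActCoact k H) : M ⊗[k] N →ₗ[k] N ⊗[k] M :=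
  TensorProduct.lift (LinearMap.mk₂ k (braid R M N)
    (fun _ _ _ => by simp only [braid_eq_braidWith, map_add])
    (fun _ _ _ => by simp only [braid_eq_braidWith, map_smul])
    (fun _ _ _ => by simp only [braid_eq, map_add])
    (fun _ _ _ => by simp only [braid_eq, map_smul]))

@[simp] lemma braidLin_tmul (R : H ⊗[k] H) (M N : ActCoact k H) (m : M) (n : N) :
    braidLin R M N (m ⊗ₜ n) = braid R M N m n := rfl

/-- The braiding is `H`-linear, by `(1 ⊗ h₁) ν(h₂) = Q Δ(h) P`: as `ν(h₂ · n)` is central in its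
second leg, `h₁` may be moved to the left of it. -/
lemma braidLin_act (hR : IsSemiquasitriangular R) (M : ActCoact k H) {N : ActCoact k H}
    (hN : IsNormal R N) (h : H) (t : M ⊗[k] N) :
    braidLin R M N (diagAct M.act N.act h t) = diagAct N.act M.act h (braidLin R M N t) := by
  induction t with
  | zero => simp
  | add s t hs ht => simp only [map_add, hs, ht]
  | tmul m n =>
    have key : ∀ t : H ⊗[k] H, braidLin R M N
        (TensorProduct.map (M.act.toLinearMap.flip m) (N.act.toLinearMap.flip n) t) =
        pairAct N M (flip R) ((M.act.toLinearMap.flip m).lTensor N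
          (N.actOn (LinearMap.mul' k (H ⊗[k] H)
            (TensorProduct.map (inr k H).toLinearMap (nu R) t)) (N.coact n))) := by
      intro t
      induction t with
      | zero => simp
      | add s t hs ht => simp only [map_add, LinearMap.add_apply, hs, ht]
      | tmul x y =>
        simp only [TensorProduct.map_tmul, LinearMap.mul'_apply, LinearMap.flip_apply,
          AlgHom.toLinearMap_apply, braidLin_tmul, braid_eq]
        rw [lTensor_act_actOn_inr _ _ _ _ (hN.coact_mem _), hN.coact_act, actOn_mul]
    rw [diagAct_tmul, key, ← conv_apply, conv_inr_nu, conjComul_apply, lTensor_act_actOn,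
      ← Module.End.mul_apply, ← map_mul, ← mul_assoc, flip_mul_flipAntipode hR, one_mul, map_mul,
      Module.End.mul_apply, ← braid_eq, ← diagAct_eq_pairAct, braidLin_tmul]

/-- The coaction commutes with the action of `R` on `N ⊗ M`, since `nu` is trivial on both legs
of `R`. -/
lemma diagCoact_pairAct_flip (hR : IsSemiquasitriangular R) {M N : ActCoact k H}
    (hM : IsNormal R M) (hN : IsNormal R N) (t : N ⊗[k] M) :
    diagCoact N.coact M.coact (pairAct N M (flip R) t) =
      (pairAct N M (flip R)).rTensor H (diagCoact N.coact M.coact t) := by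
  induction t with
  | zero => simp
  | add s t hs ht => simp only [map_add, hs, ht]
  | tmul n m =>
    rw [diagCoact_tmul]
    have h1 : ∀ T : H ⊗[k] H, diagCoact N.coact M.coact (pairAct N M (flip T) (n ⊗ₜ m)) =
        mulLegs N M H (TensorProduct.comm k _ _ (TensorProduct.map (M.actOn.flip (M.coact m))
          (N.actOn.flip (N.coact n)) (TensorProduct.map (nu R) (nu R) T))) := by
      intro T
      induction T with
      | zero => simp
      | add s t hs ht => simp only [flip_add, map_add, LinearMap.add_apply, hs, ht]
      | tmul x y => simp [diagCoact_tmul, hM.coact_act, hN.coact_act]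
    rw [h1, map_nu_nu hR]
    generalize M.coact m = X
    generalize N.coact n = Y
    generalize R = T
    induction T with
    | zero => simp
    | add s t hs ht =>
      simp only [flip_add, map_add, LinearMap.rTensor_add, LinearMap.add_apply, hs, ht]
    | tmul x y =>
    induction X with
    | zero => simp
    | add s t hs ht =>
      simp only [TensorProduct.tmul_add, map_add, hs, ht, LinearMap.add_apply,
        TensorProduct.map_tmul, TensorProduct.comm_tmul, LinearMap.flip_apply] at hs ht ⊢
    | tmul m h =>
    induction Y with
    | zero => simp
    | add s t hs ht =>
      simp only [TensorProduct.add_tmul, map_add, hs, ht, LinearMap.add_apply,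
        TensorProduct.map_tmul, TensorProduct.comm_tmul, LinearMap.flip_apply] at hs ht ⊢
    | tmul n h' => simp

/-- The coaction of `n ⊗ h · m`, for `n ⊗ h` in `N ⊗ H`, in a form to which coassociativity applies
when `n ⊗ h` is itself a coaction. -/
lemma diagCoact_lTensor_act {M : ActCoact k H} (N : ActCoact k H) (hM : IsNormal R M) (m : M)
    (X : N ⊗[k] H) :
    diagCoact N.coact M.coact ((M.act.toLinearMap.flip m).lTensor N X) =
      (TensorProduct.assoc k N M H).symm ((M.actOn.flip (M.coact m) ∘ₗ
        LinearMap.mul' k (H ⊗[k] H) ∘ₗ TensorProduct.map (inr k H).toLinearMap (nu R)).lTensor N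
          (TensorProduct.assoc k N H H (N.coact.rTensor H X))) := by
  induction X with
  | zero => simp
  | add s t hs ht => simp only [map_add, hs, ht]
  | tmul n h =>
    simp only [LinearMap.lTensor_tmul, LinearMap.flip_apply, AlgHom.toLinearMap_apply,
      LinearMap.rTensor_tmul, diagCoact_tmul, hM.coact_act]
    generalize N.coact n = Y
    induction Y with
    | zero => simp
    | add s t hs ht => simp only [TensorProduct.add_tmul, map_add, hs, ht]
    | tmul n h' =>
      simp only [TensorProduct.assoc_tmul, LinearMap.lTensor_tmul, LinearMap.comp_apply,
        TensorProduct.map_tmul, LinearMap.mul'_apply, LinearMap.flip_apply, actOn_mul,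
        AlgHom.toLinearMap_apply]
      generalize M.actOn (nu R h) (M.coact m) = Z
      induction Z with
      | zero => simp
      | add s t hs ht => simp only [TensorProduct.tmul_add, map_add, hs, ht]
      | tmul m l => simp

/-- The braiding on the first two factors of `m ⊗ n ⊗ h' h`, for `m ⊗ h'` in `M ⊗ Z(H)` and `n ⊗ h` in
`N ⊗ H`, in the form that matches `diagCoact_lTensor_act`. -/
lemma rTensor_braidLin_mulLegs (R : H ⊗[k] H) (M N : ActCoact k H) {Y : M ⊗[k] H}
    (hY : Y ∈ tensorCenter k H M) (X : N ⊗[k] H) :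
    (braidLin R M N).rTensor H (mulLegs M N H (Y ⊗ₜ X)) =
      (pairAct N M (flip R)).rTensor H ((TensorProduct.assoc k N M H).symm
        ((M.actOn.flip Y).lTensor N (TensorProduct.assoc k N H H (N.coact.rTensor H X)))) := by
  obtain ⟨Y, rfl⟩ := hY
  induction Y with
  | zero => simp
  | add s t hs ht =>
    simp only [TensorProduct.add_tmul, map_add, hs, ht, LinearMap.lTensor_add,
      LinearMap.add_apply]
  | tmul m z =>
  induction X with
  | zero => simp
  | add s t hs ht => simp only [TensorProduct.tmul_add, map_add, hs, ht]
  | tmul n h =>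
    simp only [LinearMap.lTensor_tmul, AlgHom.toLinearMap_apply, Subalgebra.coe_val, mulLegs_tmul,
      LinearMap.rTensor_tmul, braidLin_tmul, braid_eq]
    generalize N.coact n = Z
    induction Z with
    | zero => simp
    | add s t hs ht => simp only [TensorProduct.add_tmul, map_add, hs, ht]
    | tmul n h' => simp [Subalgebra.mem_center_iff.1 z.2 h]

lemma braidLin_coact (hR : IsSemiquasitriangular R) {M N : ActCoact k H} (hM : IsNormal R M)
    (hN : IsNormal R N) (t : M ⊗[k] N) :
    diagCoact N.coact M.coact (braidLin R M N t) =
      (braidLin R M N).rTensor H (diagCoact M.coact N.coact t) := by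
  induction t with
  | zero => simp
  | add s t hs ht => simp only [map_add, hs, ht]
  | tmul m n =>
    rw [braidLin_tmul, braid_eq, diagCoact_pairAct_flip hR hM hN, diagCoact_lTensor_act N hM,
      diagCoact_tmul, rTensor_braidLin_mulLegs R M N (hM.coact_mem m), N.coassoc,
      ← LinearMap.lTensor_comp_apply, ← LinearMap.lTensor_comp_apply]
    congr 2
    have h1 : (M.actOn.flip (M.coact m) ∘ₗ LinearMap.mul' k (H ⊗[k] H) ∘ₗ
        TensorProduct.map (inr k H).toLinearMap (nu R)) ∘ₗ comul =
        (M.actOn.flip (M.coact m) ∘ₗ LinearMap.mulLeft k (flipAntipode R) ∘ₗ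
          LinearMap.mulRight k (flip R)) ∘ₗ comul := by
      have h := conv_inr_nu R
      rw [conv, conjComul] at h
      simp only [LinearMap.comp_assoc]
      rw [h]
    rw [h1]
    -- here `n₁ ⊗ n₂` is central in `H ⊗ H`, so the conjugation by `flip R` disappears
    refine lTensor_comul_congr hN.coact_mem (fun y hy z hz => ?_) n
    have h2 : ∀ T : H ⊗[k] H, (y ⊗ₜ[k] z) * T = T * (y ⊗ₜ[k] z) := by
      intro T
      induction T with
      | zero => simp
      | add s t hs ht => simp only [mul_add, add_mul, hs, ht]
      | tmul a b =>
        simp [Subalgebra.mem_center_iff.1 hy a, Subalgebra.mem_center_iff.1 hz b]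
    simp only [LinearMap.comp_apply, LinearMap.mulRight_apply, LinearMap.mulLeft_apply]
    rw [h2, ← mul_assoc, flipAntipode_mul_flip hR, one_mul]

/-- `n ⊗ m ↦ n₀ ⊗ S(n₁) · m`, the inverse of `n ⊗ m ↦ n₀ ⊗ n₁ · m`. -/
def unbraid (M N : ActCoact k H) : N ⊗[k] M →ₗ[k] N ⊗[k] M :=
  TensorProduct.lift (TensorProduct.lift
    ((LinearMap.llcomp k M M (N ⊗[k] M) ∘ₗ TensorProduct.mk k N M).compl₂
      (M.act.toLinearMap ∘ₗ antipode k)) ∘ₗ N.coact)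

lemma unbraid_lTensor_act (M N : ActCoact k H) (m : M) (n : N) :
    unbraid M N ((M.act.toLinearMap.flip m).lTensor N (N.coact n)) = n ⊗ₜ m := by
  have h1 : ∀ X : N ⊗[k] H, unbraid M N ((M.act.toLinearMap.flip m).lTensor N X) =
      (M.act.toLinearMap.flip m ∘ₗ LinearMap.mul' k H ∘ₗ (antipode k).rTensor H).lTensor N
        (TensorProduct.assoc k N H H (N.coact.rTensor H X)) := by
    intro X
    induction X with
    | zero => simp
    | add s t hs ht => simp only [map_add, hs, ht]
    | tmul n h =>
      simp only [LinearMap.lTensor_tmul, LinearMap.rTensor_tmul, LinearMap.flip_apply,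
        AlgHom.toLinearMap_apply, unbraid, TensorProduct.lift.tmul, LinearMap.comp_apply]
      generalize N.coact n = Y
      induction Y with
      | zero => simp
      | add s t hs ht =>
        simp only [TensorProduct.add_tmul, map_add, LinearMap.add_apply, hs, ht]
      | tmul n h' => simp
  have h2 : (M.act.toLinearMap.flip m ∘ₗ LinearMap.mul' k H ∘ₗ (antipode k).rTensor H) ∘ₗ
      comul = LinearMap.toSpanSingleton k M m ∘ₗ counit := by
    rw [LinearMap.comp_assoc, LinearMap.comp_assoc, HopfAlgebra.mul_antipode_rTensor_comul]
    ext h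
    simp [Algebra.algebraMap_eq_smul_one]
  rw [h1, N.coassoc, ← LinearMap.lTensor_comp_apply, h2, LinearMap.lTensor_comp_apply,
    N.counit_coact]
  simp

lemma braidLin_injective (hR : IsSemiquasitriangular R) (M N : ActCoact k H) :
    Function.Injective (braidLin R M N) := by
  have h : ∀ t, unbraid M N (pairAct N M (flipAntipode R) (braidLin R M N t)) =
      TensorProduct.comm k M N t := by
    intro t
    induction t with
    | zero => simp
    | add s t hs ht => simp only [map_add, hs, ht]
    | tmul m n =>
      rw [braidLin_tmul, braid_eq, ← Module.End.mul_apply (pairAct N M _), ← map_mul, flipAntipode_mul_flip hR,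
        map_one, Module.End.one_apply, unbraid_lTensor_act, TensorProduct.comm_tmul]
  intro s t hst
  apply (TensorProduct.comm k M N).injective
  rw [← h, ← h, hst]

/-- The braiding as a linear equivalence; surjectivity comes from the equality of dimensions. -/
def braidEquiv (hR : IsSemiquasitriangular R) (M N : ActCoact k H) [FiniteDimensional k M]
    [FiniteDimensional k N] : M ⊗[k] N ≃ₗ[k] N ⊗[k] M :=
  LinearMap.linearEquivOfInjective (braidLin R M N) (braidLin_injective hR M N)
    (TensorProduct.comm k M N).finrank_eq

lemma braidLin_map (R : H ⊗[k] H) {M M' N N' : ActCoact k H} (f : M ⟶ M') (g : N ⟶ N')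
    (t : M ⊗[k] N) :
    braidLin R M' N' (TensorProduct.map f.toLin g.toLin t) =
      TensorProduct.map g.toLin f.toLin (braidLin R M N t) := by
  induction t with
  | zero => simp
  | add s t hs ht => simp only [map_add, hs, ht]
  | tmul m n =>
    simp only [TensorProduct.map_tmul, braidLin_tmul, braid_eq, g.map_coact]
    generalize N.coact n = X
    generalize flip R = T
    induction X with
    | zero => simp
    | add s t hs ht => simp only [map_add, hs, ht]
    | tmul n h =>
    induction T with
    | zero => simp
    | add s t hs ht => simp only [map_add, LinearMap.add_apply, hs, ht]
    | tmul x y => simp [f.map_act, g.map_act]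

/-- The braiding of `M` with `N ⊗ P`, from the formula for `R⁽¹⁾ ⊗ Δ(R⁽²⁾)`. -/
lemma braidLin_tensor_right (hR : IsSemiquasitriangular R) (M N : ActCoact k H) {P : ActCoact k H}
    (hP : IsNormal R P) (m : M) (n : N) (p : P) :
    TensorProduct.assoc k N P M ((M.act.toLinearMap.flip m).lTensor (N ⊗[k] P)
      (actOnOf (diagAct N.act P.act) (flip R) (diagCoact N.coact P.coact (n ⊗ₜ p)))) =
      (braidLin R M P).lTensor N (TensorProduct.assoc k N M P (braid R M N m n ⊗ₜ p)) := by
  have h1 : ∀ s : N ⊗[k] M, (braidLin R M P).lTensor N (TensorProduct.assoc k N M P (s ⊗ₜ p)) =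
      (braidWith R M P (P.coact p)).lTensor N s := by
    intro s
    induction s with
    | zero => simp
    | add s t hs ht => simp only [TensorProduct.add_tmul, map_add, hs, ht]
    | tmul n m => simp [braid_eq_braidWith]
  rw [h1, diagCoact_tmul, braid_eq]
  obtain ⟨Y, hY⟩ := hP.coact_mem p
  rw [← hY]
  clear hY h1
  generalize N.coact n = X
  induction Y with
  | zero =>
    have : braidWith R M P 0 = 0 := by ext; simp [braidWith_apply]
    simp [this]
  | add s t hs ht =>
    have h (Z Z' : P ⊗[k] H) : braidWith R M P (Z + Z') = braidWith R M P Z + braidWith R M P Z' := by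
      ext; simp [braidWith_apply]
    simp only [TensorProduct.tmul_add, map_add, hs, ht, h, LinearMap.lTensor_add,
      LinearMap.add_apply]
  | tmul p z =>
  induction X with
  | zero => simp
  | add s t hs ht => simp only [TensorProduct.add_tmul, map_add, hs, ht]
  | tmul n h =>
    set F : H ⊗[k] (H ⊗[k] H) →ₗ[k] N ⊗[k] (P ⊗[k] M) :=
      (TensorProduct.assoc k N P M).toLinearMap ∘ₗ (TensorProduct.comm k M (N ⊗[k] P)).toLinearMap ∘ₗ
        TensorProduct.map (M.act.toLinearMap.flip (M.act (h * z) m))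
          (TensorProduct.map (N.act.toLinearMap.flip n) (P.act.toLinearMap.flip p)) with hF
    have h1 : ∀ T : H ⊗[k] H, TensorProduct.assoc k N P M
        ((M.act.toLinearMap.flip m).lTensor (N ⊗[k] P)
          (actOnOf (diagAct N.act P.act) (flip T) ((n ⊗ₜ p) ⊗ₜ (h * z)))) = F (comulRight T) := by
      intro T
      induction T with
      | zero => simp [comulRight]
      | add s t hs ht =>
        rw [comulRight] at hs ht
        simp only [comulRight, flip_add, map_add, LinearMap.add_apply, hs, ht]
      | tmul a b =>
        simp only [flip_tmul, actOnOf_tmul, LinearMap.lTensor_tmul, comulRight, diagAct_tmul]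
        generalize comul (R := k) b = w
        induction w with
        | zero => simp
        | add s t hs ht =>
          simp only [TensorProduct.add_tmul, TensorProduct.tmul_add, map_add, hs, ht]
        | tmul b b' => simp [hF]
    have h2 : ∀ T T' : H ⊗[k] H, F (leg13 T * leg12 T') =
        (braidWith T M P (p ⊗ₜ (z : H))).lTensor N (pairAct N M (flip T')
          (n ⊗ₜ M.act h m)) := by
      intro T T'
      induction T with
      | zero =>
        have : braidWith 0 M P (p ⊗ₜ (z : H)) = 0 := by ext; simp [braidWith_apply]
        simp [this]
      | add s t hs ht =>
        have : braidWith (s + t) M P (p ⊗ₜ (z : H)) =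
            braidWith s M P (p ⊗ₜ (z : H)) + braidWith t M P (p ⊗ₜ (z : H)) := by
          ext; simp [braidWith_apply]
        simp only [leg13_add, add_mul, map_add, hs, ht, this, LinearMap.lTensor_add,
          LinearMap.add_apply]
      | tmul a b =>
      induction T' with
      | zero => simp
      | add s t hs ht =>
        simp only [leg12_add, mul_add, flip_add, map_add, LinearMap.add_apply, hs, ht]
      | tmul a' b' =>
        have hz := Subalgebra.mem_center_iff.1 z.2 (a' * h)
        simp only [hF, leg13_tmul, leg12_tmul, Algebra.TensorProduct.tmul_mul_tmul, one_mul,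
          mul_one, LinearMap.comp_apply, LinearEquiv.coe_coe, TensorProduct.map_tmul,
          LinearMap.flip_apply, AlgHom.toLinearMap_apply, TensorProduct.comm_tmul,
          TensorProduct.assoc_tmul, flip_tmul, pairAct_tmul, LinearMap.lTensor_tmul,
          braidWith_apply, ← Module.End.mul_apply, ← map_mul]
        rw [mul_assoc a a', ← mul_assoc a' h, hz]
    simp only [LinearMap.lTensor_tmul, AlgHom.toLinearMap_apply, Subalgebra.coe_val, mulLegs_tmul,
      LinearMap.flip_apply] at h1 h2 ⊢
    rw [h1, hR.comul_right, h2]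

/-- The action of `H ⊗ (H ⊗ H)` on `P ⊗ (H ⊗ H)` in which the third leg acts on `P`. -/
def legAct (P : ActCoact k H) : H ⊗[k] (H ⊗[k] H) →ₗ[k] Module.End k (P ⊗[k] (H ⊗[k] H)) :=
  TensorProduct.homTensorHomMap (RingHom.id k) P (H ⊗[k] H) P (H ⊗[k] H) ∘ₗ
    TensorProduct.map P.act.toLinearMap (LinearMap.mul k (H ⊗[k] H)) ∘ₗ
      (TensorProduct.comm k (H ⊗[k] H) H).toLinearMap ∘ₗ
        (TensorProduct.assoc k H H H).symm.toLinearMap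

@[simp] lemma legAct_tmul (P : ActCoact k H) (x y z : H) (p : P) (w : H ⊗[k] H) :
    legAct P (x ⊗ₜ (y ⊗ₜ z)) (p ⊗ₜ w) = P.act z p ⊗ₜ ((x ⊗ₜ y) * w) := by
  simp [legAct]

/-- The braiding of `M ⊗ N` with `P`, from the formula for `Δ(R⁽¹⁾) ⊗ R⁽²⁾`. -/
lemma braidLin_tensor_left (hR : IsSemiquasitriangular R) (M N : ActCoact k H) {P : ActCoact k H}
    (hP : IsNormal R P) (m : M) (n : N) (p : P) :
    (TensorProduct.assoc k P M N).symm (((diagAct M.act N.act).toLinearMap.flip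
      (m ⊗ₜ n)).lTensor P (P.actOn (flip R) (P.coact p))) =
      (braidLin R M P).rTensor N ((TensorProduct.assoc k M P N).symm (m ⊗ₜ braid R N P n p)) := by
  set B : P ⊗[k] (H ⊗[k] H) →ₗ[k] (P ⊗[k] M) ⊗[k] N :=
    (TensorProduct.assoc k P M N).symm.toLinearMap ∘ₗ (TensorProduct.map
      (M.act.toLinearMap.flip m) (N.act.toLinearMap.flip n)).lTensor P with hB
  have h1 : ∀ (T : H ⊗[k] H) (X : P ⊗[k] H), (TensorProduct.assoc k P M N).symm
      (((diagAct M.act N.act).toLinearMap.flip (m ⊗ₜ n)).lTensor P (P.actOn (flip T) X)) =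
      B (legAct P (comulLeft T) (comul.lTensor P X)) := by
    intro T X
    induction T with
    | zero => simp [comulLeft]
    | add s t hs ht =>
      rw [comulLeft] at hs ht
      simp only [comulLeft, flip_add, map_add, LinearMap.add_apply, hs, ht]
    | tmul a b =>
    induction X with
    | zero => simp
    | add s t hs ht => simp only [map_add, hs, ht]
    | tmul p h =>
      simp only [flip_tmul, actOn_tmul, LinearMap.lTensor_tmul, comulLeft, LinearMap.rTensor_tmul,
        LinearMap.flip_apply, AlgHom.toLinearMap_apply, diagAct_tmul, Bialgebra.comul_mul]
      generalize comul (R := k) h = w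
      generalize comul (R := k) a = v
      induction v with
      | zero => simp
      | add s t hs ht =>
        simp only [TensorProduct.add_tmul, TensorProduct.tmul_add, add_mul, map_add,
          LinearMap.add_apply, hs, ht]
      | tmul c d => simp [hB]
  -- `ν(R⁽²⁾) = R⁽²⁾ ⊗ 1` gives the coaction on the first tensor factor of `braid R N P n p`
  have h2 : ∀ (p : P) (n : N), (braidLin R M P).rTensor N ((TensorProduct.assoc k M P N).symm
      (m ⊗ₜ pairAct P N (flip R) (p ⊗ₜ n))) =
      TensorProduct.map (pairAct P M (flip R) ∘ₗ (M.act.toLinearMap.flip m).lTensor P ∘ₗ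
        P.actOn.flip (P.coact p)) (N.act.toLinearMap.flip n)
          (TensorProduct.comm k _ _ ((inl k H).toLinearMap.lTensor H R)) := by
    intro p n
    rw [← lTensor_nu hR]
    have : ∀ T : H ⊗[k] H, (braidLin R M P).rTensor N ((TensorProduct.assoc k M P N).symm
      (m ⊗ₜ pairAct P N (flip T) (p ⊗ₜ n))) =
      TensorProduct.map (pairAct P M (flip R) ∘ₗ (M.act.toLinearMap.flip m).lTensor P ∘ₗ
        P.actOn.flip (P.coact p)) (N.act.toLinearMap.flip n)
          (TensorProduct.comm k _ _ ((nu R).lTensor H T)) := by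
      intro T
      induction T with
      | zero => simp
      | add s t hs ht =>
        simp only [flip_add, map_add, LinearMap.add_apply, TensorProduct.tmul_add, hs, ht]
      | tmul x y => simp [braid_eq, hP.coact_act]
    exact this R
  have h3 : ∀ X : P ⊗[k] H, (braidLin R M P).rTensor N ((TensorProduct.assoc k M P N).symm
      (m ⊗ₜ pairAct P N (flip R) ((N.act.toLinearMap.flip n).lTensor P X))) =
      B (legAct P (leg13 R * leg23 R) (TensorProduct.assoc k P H H (P.coact.rTensor H X))) := by
    intro X
    induction X with
    | zero => simp
    | add s t hs ht => simp only [TensorProduct.tmul_add, map_add, hs, ht]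
    | tmul p h =>
      rw [LinearMap.lTensor_tmul, h2, LinearMap.rTensor_tmul]
      generalize P.coact p = Y
      have : ∀ T T' : H ⊗[k] H, TensorProduct.map (pairAct P M (flip T) ∘ₗ
          (M.act.toLinearMap.flip m).lTensor P ∘ₗ P.actOn.flip Y)
          (N.act.toLinearMap.flip (N.act h n))
          (TensorProduct.comm k _ _ ((inl k H).toLinearMap.lTensor H T')) =
          B (legAct P (leg13 T * leg23 T') (TensorProduct.assoc k P H H (Y ⊗ₜ h))) := by
        intro T T'
        induction T' with
        | zero => simp
        | add s t hs ht => simp only [leg23_add, mul_add, map_add, LinearMap.add_apply, hs, ht]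
        | tmul a' b' =>
        simp only [LinearMap.lTensor_tmul, TensorProduct.comm_tmul, TensorProduct.map_tmul,
          LinearMap.comp_apply, LinearMap.flip_apply]
        induction T with
        | zero => simp
        | add s t hs ht =>
          simp only [leg13_add, flip_add, add_mul, map_add, LinearMap.add_apply,
            TensorProduct.add_tmul, hs, ht]
        | tmul a b =>
        induction Y with
        | zero => simp
        | add s t hs ht => simp only [TensorProduct.add_tmul, map_add, hs, ht]
        | tmul p l => simp [hB]
      exact this R R
  rw [h1, braid_eq, h3, hR.comul_left, P.coassoc]

end Braid
end ActCoact

/-! ### The inverse antipode -/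

section AntipodeInv

variable {k : Type u} [Field k] {H : Type v} [Ring H] [HopfAlgebra k H]

lemma antipodeInv_mem_center (hS : Function.Bijective (antipode k (A := H))) {z : H}
    (hz : z ∈ Subalgebra.center k H) :
    antipodeInv k hS z ∈ Subalgebra.center k H := by
  rw [Subalgebra.mem_center_iff]
  intro y
  apply hS.1
  rw [antipode_mul_antidistrib, antipode_mul_antidistrib, antipode_antipodeInv]
  exact (Subalgebra.mem_center_iff.1 hz _).symm

/-- `h₂ S⁻¹(h₁) = ε(h)`. -/
lemma mul_antipodeInv_comm_comul (hS : Function.Bijective (antipode k (A := H))) :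
    LinearMap.mul' k H ∘ₗ (TensorProduct.comm k H H).toLinearMap ∘ₗ
      (antipodeInv k hS).rTensor H ∘ₗ comul = Algebra.linearMap k H ∘ₗ counit := by
  ext h
  apply hS.1
  have h1 : ∀ t : H ⊗[k] H, antipode k (LinearMap.mul' k H (TensorProduct.comm k H H
      ((antipodeInv k hS).rTensor H t))) = LinearMap.mul' k H ((antipode k).lTensor H t) := by
    intro t
    induction t with
    | zero => simp
    | add s t hs ht => simp only [map_add, hs, ht]
    | tmul x y => simp [antipode_mul_antidistrib, antipode_antipodeInv]
  refine (h1 _).trans ?_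
  rw [HopfAlgebra.mul_antipode_lTensor_comul_apply]
  simp [Algebra.algebraMap_eq_smul_one, antipode_one]

/-- `S⁻¹(h₂) h₁ = ε(h)`. -/
lemma antipodeInv_mul_comm_comul (hS : Function.Bijective (antipode k (A := H))) :
    LinearMap.mul' k H ∘ₗ (TensorProduct.comm k H H).toLinearMap ∘ₗ
      (antipodeInv k hS).lTensor H ∘ₗ comul = Algebra.linearMap k H ∘ₗ counit := by
  ext h
  apply hS.1
  have h1 : ∀ t : H ⊗[k] H, antipode k (LinearMap.mul' k H (TensorProduct.comm k H H
      ((antipodeInv k hS).lTensor H t))) = LinearMap.mul' k H ((antipode k).rTensor H t) := by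
    intro t
    induction t with
    | zero => simp
    | add s t hs ht => simp only [map_add, hs, ht]
    | tmul x y => simp [antipode_mul_antidistrib, antipode_antipodeInv]
  refine (h1 _).trans ?_
  rw [HopfAlgebra.mul_antipode_rTensor_comul_apply]
  simp [Algebra.algebraMap_eq_smul_one, antipode_one]

end AntipodeInv

namespace ActCoact

/-! ### The dual of a normal module -/

section Dual

variable {k : Type u} [Field k] {H : Type v} [Ring H] [HopfAlgebra k H] {R : H ⊗[k] H}

lemma evalLeft_mem_center {V : Type w} [AddCommGroup V] [Module k V] (f : Module.Dual k V)
    {X : V ⊗[k] H} (hX : X ∈ tensorCenter k H V) : evalLeft V f X ∈ Subalgebra.center k H := by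
  obtain ⟨X, rfl⟩ := hX
  induction X with
  | zero => simp
  | add s t hs ht => simp only [map_add, add_mem hs ht]
  | tmul m z =>
    simp only [LinearMap.lTensor_tmul, evalLeft_tmul]
    exact Subalgebra.smul_mem _ z.2 _

lemma evalLeft_actOn (M : ActCoact k H) (f : Module.Dual k M) (x z : H) (X : M ⊗[k] H) :
    evalLeft M f (M.actOn (x ⊗ₜ z) X) = z * evalLeft M f (M.actOn (x ⊗ₜ 1) X) := by
  induction X with
  | zero => simp
  | add s t hs ht => simp only [map_add, mul_add, hs, ht]
  | tmul m h => simp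

/-- The evaluation `f ⊗ h ↦ f(m) h`. -/
def evalAt (M : ActCoact k H) (m : M) : Module.Dual k M ⊗[k] H →ₗ[k] H :=
  evalLeft (Module.Dual k M) (Module.Dual.eval k M m)

@[simp] lemma evalAt_tmul (M : ActCoact k H) (m : M) (f : Module.Dual k M) (h : H) :
    evalAt M m (f ⊗ₜ h) = f m • h := by
  simp [evalAt]

/-- Elements of `M* ⊗ H` are separated by evaluation in `M`, as `M` is finite-dimensional. -/
lemma dual_tensor_ext (M : ActCoact k H) [FiniteDimensional k M] {X Y : Module.Dual k M ⊗[k] H}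
    (h : ∀ m, evalAt M m X = evalAt M m Y) : X = Y := by
  have expand : ∀ X : Module.Dual k M ⊗[k] H, X = ∑ i, (Module.finBasis k M).coord i ⊗ₜ[k]
      evalAt M (Module.finBasis k M i) X := by
    intro X
    induction X with
    | zero => simp
    | add s t hs ht =>
      conv_lhs => rw [hs, ht]
      simp only [map_add, TensorProduct.tmul_add, Finset.sum_add_distrib]
    | tmul f h =>
      conv_lhs => rw [← (Module.finBasis k M).sum_dual_apply_smul_coord f]
      simp only [TensorProduct.sum_tmul, evalAt_tmul, TensorProduct.smul_tmul]
  rw [expand X, expand Y]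
  simp only [h]

variable (hS : Function.Bijective (antipode k (A := H)))

lemma evalAt_dualCoact (M : ActCoact k H) [FiniteDimensional k M] (f : Module.Dual k M) (m : M) :
    evalAt M m (dualCoact M hS f) = antipodeInv k hS (evalLeft M f (M.coact m)) := by
  rw [dualCoact_apply, map_sum]
  simp only [evalAt_tmul, Module.Basis.coord_apply, ← map_smul, ← map_sum]
  rw [(Module.finBasis k M).sum_repr]

lemma evalAt_actOnOf (M : ActCoact k H) (x z : H) (m : M) (X : Module.Dual k M ⊗[k] H) :
    evalAt M m (actOnOf (dualAct M) (x ⊗ₜ z) X) = z * evalAt M (M.act (antipode k x) m) X := by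
  induction X with
  | zero => simp
  | add s t hs ht => simp only [map_add, mul_add, hs, ht]
  | tmul f h => simp [dualAct_apply]

/-- The action of `H ⊗ H` on `ν(f)` is dual to the action on `ν(m)`, through the map
`x ⊗ z ↦ ν(S(x)) (1 ⊗ S(z))`. -/
lemma antipode_evalAt_actOnOf (hR : IsSemiquasitriangular R) {M : ActCoact k H}
    [FiniteDimensional k M] (hM : IsNormal R M) (s : H ⊗[k] H) (f : Module.Dual k M) (m : M) :
    antipode k (evalAt M m (actOnOf (dualAct M) s (dualCoact M hS f))) =
      evalLeft M f (M.actOn (nuAntipode R s) (M.coact m)) := by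
  induction s with
  | zero => simp
  | add s t hs ht => simp only [map_add, LinearMap.add_apply, hs, ht]
  | tmul x z =>
    have hc := evalLeft_mem_center f (hM.coact_mem (M.act (antipode k x) m))
    rw [evalAt_actOnOf, antipode_mul_antidistrib, evalAt_dualCoact, antipode_antipodeInv,
      nuAntipode_tmul, nu_mul_inr hR, ← Subalgebra.mem_center_iff.1 hc, hM.coact_act, actOn_mul,
      inr_apply, evalLeft_actOn, ← Algebra.TensorProduct.one_def, actOn_one]

lemma isNormal_dual (hR : IsSemiquasitriangular R) {M : ActCoact k H} [FiniteDimensional k M]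
    (hM : IsNormal R M) : IsNormal R (M.dual hS) where
  coact_mem f := by
    change Module.Dual k M at f
    change dualCoact M hS f ∈ tensorCenter k H (Module.Dual k M)
    rw [dualCoact_apply]
    refine sum_mem fun i _ => tmul_mem_tensorCenter _ _ (antipodeInv_mem_center hS ?_)
    exact evalLeft_mem_center f (hM.coact_mem _)
  coact_act h f := by
    change Module.Dual k M at f
    change dualCoact M hS (dualAct M h f) = actOnOf (dualAct M) (nu R h) (dualCoact M hS f)
    refine dual_tensor_ext M fun m => hS.1 ?_
    rw [antipode_evalAt_actOnOf hS hR hM, nuAntipode_nu hR, evalAt_dualCoact, antipode_antipodeInv]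
    generalize M.coact m = X
    induction X with
    | zero => simp
    | add s t hs ht => simp only [map_add, hs, ht]
    | tmul m l => simp [dualAct_apply]

lemma contractLeft_act (M : ActCoact k H) (h : H) (t : Module.Dual k M ⊗[k] M) :
    contractLeft k M (diagAct (dualAct M) M.act h t) = trivialAct k H h (contractLeft k M t) := by
  induction t with
  | zero => simp
  | add s t hs ht => simp only [map_add, hs, ht]
  | tmul f m =>
    rw [diagAct_tmul]
    have h1 : ∀ t : H ⊗[k] H, contractLeft k M (TensorProduct.map
        ((dualAct M).toLinearMap.flip f) (M.act.toLinearMap.flip m) t) =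
        f (M.act (LinearMap.mul' k H ((antipode k).rTensor H t)) m) := by
      intro t
      induction t with
      | zero => simp
      | add s t hs ht => simp only [map_add, LinearMap.add_apply, hs, ht]
      | tmul x y => simp [dualAct_apply]
    rw [h1, HopfAlgebra.mul_antipode_rTensor_comul_apply]
    simp [trivialAct, Algebra.ofId_apply, Algebra.algebraMap_eq_smul_one]

/-- The evaluation is colinear: by centrality the claim is `f(m₀) m₂ S⁻¹(m₁) = f(m)`. -/
lemma contractLeft_coact (M : ActCoact k H) [FiniteDimensional k M]
    (hM : ∀ m, M.coact m ∈ tensorCenter k H M) (t : Module.Dual k M ⊗[k] M) :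
    trivialCoact k H (contractLeft k M t) =
      (contractLeft k M).rTensor H (diagCoact (dualCoact M hS) M.coact t) := by
  induction t with
  | zero => simp
  | add s t hs ht => simp only [map_add, hs, ht]
  | tmul f m =>
    rw [diagCoact_tmul]
    have h1 : ∀ (m : M) (z : H) (Y : Module.Dual k M ⊗[k] H),
        (contractLeft k M).rTensor H (mulLegs _ M H (Y ⊗ₜ (m ⊗ₜ z))) =
          (1 : k) ⊗ₜ (evalAt M m Y * z) := by
      intro m z Y
      induction Y with
      | zero => simp
      | add s t hs ht =>
        simp only [TensorProduct.add_tmul, TensorProduct.tmul_add, map_add, add_mul, hs, ht]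
      | tmul g y =>
        simp only [mulLegs_tmul, LinearMap.rTensor_tmul, contractLeft_apply, evalAt_tmul,
          smul_mul_assoc]
        rw [← TensorProduct.smul_tmul, smul_eq_mul, mul_one]
    set F : M ⊗[k] (H ⊗[k] H) →ₗ[k] H := (TensorProduct.lid k H).toLinearMap ∘ₗ
      TensorProduct.map f (LinearMap.mul' k H ∘ₗ (TensorProduct.comm k H H).toLinearMap ∘ₗ
        (antipodeInv k hS).rTensor H) with hF
    have h2 : ∀ X ∈ tensorCenter k H M,
        (contractLeft k M).rTensor H (mulLegs _ M H (dualCoact M hS f ⊗ₜ X)) =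
          (1 : k) ⊗ₜ F (TensorProduct.assoc k M H H (M.coact.rTensor H X)) := by
      rintro _ ⟨X, rfl⟩
      induction X with
      | zero => simp
      | add s t hs ht => simp only [TensorProduct.tmul_add, map_add, hs, ht]
      | tmul m z =>
        rw [LinearMap.lTensor_tmul, h1, evalAt_dualCoact, LinearMap.rTensor_tmul]
        congr 1
        generalize M.coact m = Y
        induction Y with
        | zero => simp
        | add s t hs ht => simp only [TensorProduct.add_tmul, map_add, add_mul, hs, ht]
        | tmul m h => simp [hF, Subalgebra.mem_center_iff.1 z.2]
    have h3 : F ∘ₗ comul.lTensor M = (TensorProduct.lid k H).toLinearMap ∘ₗ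
        TensorProduct.map f (Algebra.linearMap k H) ∘ₗ counit.lTensor M := by
      apply TensorProduct.ext'
      intro m h
      have := congr($(mul_antipodeInv_comm_comul hS) h)
      simp only [LinearMap.comp_apply, LinearEquiv.coe_coe] at this
      simp [hF, this]
    rw [h2 _ (hM m), M.coassoc, ← LinearMap.comp_apply F, h3, LinearMap.comp_apply,
      LinearMap.comp_apply, M.counit_coact]
    simp only [contractLeft_apply, trivialCoact, LinearMap.flip_apply, TensorProduct.mk_apply,
      TensorProduct.map_tmul, Algebra.linearMap_apply, map_one, LinearEquiv.coe_coe,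
      TensorProduct.lid_tmul]
    rw [← TensorProduct.smul_tmul, smul_eq_mul, mul_one]

/-- The contraction `m ⊗ f ↦ f(x) m`. -/
def contractAt (M : ActCoact k H) (x : M) : M ⊗[k] Module.Dual k M →ₗ[k] M :=
  (TensorProduct.rid k M).toLinearMap ∘ₗ (Module.Dual.eval k M x).lTensor M

@[simp] lemma contractAt_tmul (M : ActCoact k H) (x m : M) (f : Module.Dual k M) :
    contractAt M x (m ⊗ₜ f) = f x • m := by
  simp [contractAt]

lemma contractAt_expand (M : ActCoact k H) [FiniteDimensional k M] :
    ∑ i, (TensorProduct.mk k M (Module.Dual k M)).flip ((Module.finBasis k M).coord i) ∘ₗ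
      contractAt M (Module.finBasis k M i) = LinearMap.id := by
  apply TensorProduct.ext'
  intro m f
  conv_rhs => rw [← (Module.finBasis k M).sum_dual_apply_smul_coord f]
  simp only [LinearMap.sum_apply, LinearMap.comp_apply, contractAt_tmul, LinearMap.flip_apply,
    TensorProduct.mk_apply, TensorProduct.tmul_sum, TensorProduct.smul_tmul, LinearMap.id_apply]

lemma contractAt_ext (M : ActCoact k H) [FiniteDimensional k M] {s t : M ⊗[k] Module.Dual k M}
    (h : ∀ x, contractAt M x s = contractAt M x t) : s = t := by
  have := contractAt_expand M
  rw [← LinearMap.id_apply (R := k) s, ← LinearMap.id_apply (R := k) t, ← this]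
  simp [h]

lemma rTensor_contractAt_ext (M : ActCoact k H) [FiniteDimensional k M]
    {s t : (M ⊗[k] Module.Dual k M) ⊗[k] H}
    (h : ∀ x, (contractAt M x).rTensor H s = (contractAt M x).rTensor H t) : s = t := by
  have := congrArg (LinearMap.rTensor H) (contractAt_expand M)
  rw [LinearMap.rTensor_id] at this
  rw [← LinearMap.id_apply (R := k) s, ← LinearMap.id_apply (R := k) t, ← this]
  have e : ∀ s : (M ⊗[k] Module.Dual k M) ⊗[k] H, LinearMap.rTensor H (∑ i,
      (TensorProduct.mk k M (Module.Dual k M)).flip ((Module.finBasis k M).coord i) ∘ₗ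
        contractAt M (Module.finBasis k M i)) s = ∑ i, ((TensorProduct.mk k M
          (Module.Dual k M)).flip ((Module.finBasis k M).coord i)).rTensor H
            ((contractAt M (Module.finBasis k M i)).rTensor H s) := by
    intro s
    simp only [← LinearMap.rTensor_comp_apply]
    rw [← LinearMap.coe_rTensorHom, map_sum, LinearMap.sum_apply]
  rw [e, e]
  simp only [h]

lemma coevaluation_act (M : ActCoact k H) [FiniteDimensional k M] (h : H) (c : k) :
    coevaluation k M (trivialAct k H h c) =
      diagAct M.act (dualAct M) h (coevaluation k M c) := by
  suffices coevaluation k M ∘ₗ trivialAct k H h =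
      diagAct M.act (dualAct M) h ∘ₗ coevaluation k M from congr($this c)
  apply LinearMap.ext_ring
  refine contractAt_ext M fun x => ?_
  set b := Module.Basis.ofVectorSpace k M with hb
  have h1 : ∀ t : H ⊗[k] H, contractAt M x (∑ i, TensorProduct.map (M.act.toLinearMap.flip (b i))
      ((dualAct M).toLinearMap.flip (b.coord i)) t) =
      M.act (LinearMap.mul' k H ((antipode k).lTensor H t)) x := by
    intro t
    induction t with
    | zero => simp
    | add s t hs ht =>
      simp only [map_add, Finset.sum_add_distrib, LinearMap.add_apply, hs, ht]
    | tmul y z =>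
      simp only [TensorProduct.map_tmul, map_sum, contractAt_tmul, LinearMap.flip_apply,
        AlgHom.toLinearMap_apply, dualAct_apply, Module.Basis.coord_apply, ← map_smul]
      rw [← map_sum, b.sum_repr]
      simp
  have h2 : contractAt M x (coevaluation k M 1) = x := by
    rw [coevaluation_apply_one]
    simp only [← hb, map_sum, contractAt_tmul, Module.Basis.coord_apply]
    exact b.sum_repr x
  have h3 : trivialAct k H h 1 = counit (R := k) h := by
    simp [trivialAct, Algebra.ofId_apply, Algebra.algebraMap_eq_smul_one]
  have h4 : coevaluation k M (counit (R := k) h) = counit (R := k) h • coevaluation k M 1 := by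
    rw [← map_smul, smul_eq_mul, mul_one]
  rw [LinearMap.comp_apply, LinearMap.comp_apply, h3, h4, map_smul, h2, coevaluation_apply_one]
  simp only [← hb]
  rw [map_sum]
  simp only [diagAct_tmul]
  rw [h1, HopfAlgebra.mul_antipode_lTensor_comul_apply]
  simp [Algebra.algebraMap_eq_smul_one]

/-- The coevaluation is colinear: contracted with `x`, the claim is `x₀ ⊗ x₁ S⁻¹(x₂) = x ⊗ 1`, and
by centrality `x₁ S⁻¹(x₂) = S⁻¹(x₂) x₁`. -/
lemma coevaluation_coact (M : ActCoact k H) [FiniteDimensional k M]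
    (hM : ∀ m, M.coact m ∈ tensorCenter k H M) (c : k) :
    diagCoact M.coact (dualCoact M hS) (coevaluation k M c) =
      (coevaluation k M).rTensor H (trivialCoact k H c) := by
  suffices diagCoact M.coact (dualCoact M hS) ∘ₗ coevaluation k M =
      (coevaluation k M).rTensor H ∘ₗ trivialCoact k H from congr($this c)
  apply LinearMap.ext_ring
  refine rTensor_contractAt_ext M fun x => ?_
  set b := Module.Basis.ofVectorSpace k M with hb
  have h1 : contractAt M x (coevaluation k M 1) = x := by
    rw [coevaluation_apply_one]
    simp only [← hb, map_sum, contractAt_tmul, Module.Basis.coord_apply]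
    exact b.sum_repr x
  have h2 : ∀ (X : M ⊗[k] H) (Y : Module.Dual k M ⊗[k] H),
      (contractAt M x).rTensor H (mulLegs M _ H (X ⊗ₜ Y)) =
        (LinearMap.mulRight k (evalAt M x Y)).lTensor M X := by
    intro X Y
    induction X with
    | zero => simp
    | add s t hs ht => simp only [TensorProduct.add_tmul, map_add, hs, ht]
    | tmul m h =>
      rw [LinearMap.lTensor_tmul, LinearMap.mulRight_apply]
      induction Y with
      | zero => simp
      | add s t hs ht =>
        simp only [TensorProduct.tmul_add, map_add, mul_add, hs, ht]
      | tmul f y => simp [TensorProduct.smul_tmul]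
  have h3 : ∀ X : M ⊗[k] H, ∑ i, (LinearMap.mulRight k (antipodeInv k hS
      (evalLeft M (b.coord i) X))).lTensor M (M.coact (b i)) =
      (LinearMap.mul' k H ∘ₗ (antipodeInv k hS).lTensor H).lTensor M
        (TensorProduct.assoc k M H H (M.coact.rTensor H X)) := by
    have hadd : ∀ (y z : H) (Z : M ⊗[k] H), (LinearMap.mulRight k (y + z)).lTensor M Z =
        (LinearMap.mulRight k y).lTensor M Z + (LinearMap.mulRight k z).lTensor M Z := by
      intro y z Z
      rw [← LinearMap.add_apply, ← LinearMap.lTensor_add]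
      congr 2
      ext; simp [mul_add]
    have hsmul : ∀ (a : k) (y : H) (Z : M ⊗[k] H), (LinearMap.mulRight k (a • y)).lTensor M Z =
        (LinearMap.mulRight k y).lTensor M (a • Z) := by
      intro a y Z
      rw [map_smul, ← LinearMap.smul_apply, ← LinearMap.lTensor_smul]
      congr 2
      ext; simp
    intro X
    induction X with
    | zero =>
      have : LinearMap.mulRight k (0 : H) = 0 := by ext; simp
      simp [this]
    | add s t hs ht => simp only [map_add, hadd, Finset.sum_add_distrib, hs, ht]
    | tmul m h =>
      simp only [evalLeft_tmul, map_smul, hsmul, Module.Basis.coord_apply]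
      simp only [← map_smul, ← map_sum]
      rw [b.sum_repr, LinearMap.rTensor_tmul]
      generalize M.coact m = Z
      induction Z with
      | zero => simp
      | add s t hs ht => simp only [TensorProduct.add_tmul, map_add, hs, ht]
      | tmul m y => simp
  have h4 : (LinearMap.mul' k H ∘ₗ (antipodeInv k hS).lTensor H ∘ₗ comul).lTensor M (M.coact x) =
      x ⊗ₜ 1 := by
    have e := lTensor_comul_congr (N := M) hM
      (F := LinearMap.mul' k H ∘ₗ (antipodeInv k hS).lTensor H)
      (F' := LinearMap.mul' k H ∘ₗ (TensorProduct.comm k H H).toLinearMap ∘ₗ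
        (antipodeInv k hS).lTensor H)
      (fun y hy z _ => by simp [Subalgebra.mem_center_iff.1 hy]) x
    simp only [LinearMap.comp_assoc, antipodeInv_mul_comm_comul] at e
    rw [e, LinearMap.lTensor_comp_apply, M.counit_coact]
    simp
  rw [LinearMap.comp_apply, LinearMap.comp_apply, coevaluation_apply_one]
  simp only [← hb]
  simp only [map_sum, diagCoact_tmul, h2, evalAt_dualCoact]
  rw [h3, M.coassoc, ← LinearMap.lTensor_comp_apply, LinearMap.comp_assoc, h4]
  simp [trivialCoact, h1]

end Dual
end ActCoact

/-! ### The category of normal modules -/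

section Category

open ActCoact

variable {k : Type u} [Field k] {H : Type v} [Ring H] [HopfAlgebra k H] {R : H ⊗[k] H}

lemma isMonoidal_finNormal (hR : IsSemiquasitriangular R) : (finNormal R).IsMonoidal where
  prop_unit := ⟨isNormal_unit hR, inferInstanceAs (FiniteDimensional k k)⟩
  prop_tensor M N hM hN := by
    have := hM.2
    have := hN.2
    exact ⟨isNormal_tensor hR hM.1 hN.1, inferInstanceAs (FiniteDimensional k (M ⊗[k] N))⟩

/-- The braiding as an isomorphism of normal modules. -/
def braidIso (hR : IsSemiquasitriangular R) [(finNormal R).IsMonoidal] (M N : FinNormal R) :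
    M ⊗ N ≅ N ⊗ M :=
  (finNormal R).isoMk (isoMk (M := tensor M.obj N.obj) (N := tensor N.obj M.obj)
    (braidEquiv hR M.obj N.obj) (braidLin_act hR M.obj N.property.1)
    (braidLin_coact hR M.property.1 N.property.1))

lemma finNormal_hom_ext {M N : FinNormal R} {f g : M ⟶ N}
    (h : FinNormal.toLin f = FinNormal.toLin g) : f = g :=
  ObjectProperty.hom_ext _ (ActCoact.hom_ext h)

/-- The braided structure on the category of finite-dimensional normal modules. -/
@[reducible] def braidedCategory (hR : IsSemiquasitriangular R) [(finNormal R).IsMonoidal] :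
    BraidedCategory (FinNormal R) where
  braiding := braidIso hR
  braiding_naturality_right M N P f := by
    refine finNormal_hom_ext (LinearMap.ext fun t => ?_)
    exact braidLin_map R (𝟙 M.obj) f.hom t
  braiding_naturality_left f P := by
    refine finNormal_hom_ext (LinearMap.ext fun t => ?_)
    exact braidLin_map R f.hom (𝟙 P.obj) t
  hexagon_forward M N P := by
    refine finNormal_hom_ext (TensorProduct.ext_threefold fun m n p => ?_)
    exact braidLin_tensor_right hR M.obj N.obj P.property.1 m n p
  hexagon_reverse M N P := by
    refine finNormal_hom_ext (TensorProduct.ext (LinearMap.ext fun m =>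
      TensorProduct.ext' fun n p => ?_))
    exact braidLin_tensor_left hR M.obj N.obj P.property.1 m n p

/-- The dual of a finite-dimensional normal module. -/
def finDual (hR : IsSemiquasitriangular R) (M : FinNormal R) : FinNormal R :=
  ⟨M.obj.dual hR.bijective_antipode, isNormal_dual _ hR M.property.1,
    inferInstanceAs (FiniteDimensional k (Module.Dual k M.obj))⟩

/-- The usual evaluation and coevaluation make `M*` a left dual of `M`. -/
@[reducible] def exactPairing (hR : IsSemiquasitriangular R) [(finNormal R).IsMonoidal] (M : FinNormal R) :
    ExactPairing M (finDual hR M) where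
  coevaluation' := ObjectProperty.homMk
    (⟨coevaluation k M.obj, coevaluation_act M.obj,
      coevaluation_coact hR.bijective_antipode M.obj M.property.1.coact_mem⟩ :
      unit k H ⟶ tensor M.obj (M.obj.dual hR.bijective_antipode))
  evaluation' := ObjectProperty.homMk
    (⟨contractLeft k M.obj, contractLeft_act M.obj,
      contractLeft_coact hR.bijective_antipode M.obj M.property.1.coact_mem⟩ :
      tensor (M.obj.dual hR.bijective_antipode) M.obj ⟶ unit k H)
  coevaluation_evaluation' :=
    finNormal_hom_ext (contractLeft_assoc_coevaluation k M.obj)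
  evaluation_coevaluation' :=
    finNormal_hom_ext (contractLeft_assoc_coevaluation' k M.obj)

end Category

end

end SemiQT

theorem corollary2p10 {k : Type u} [Field k] {H : Type v} [Ring H] [HopfAlgebra k H]
    (R : H ⊗[k] H) (hR : SemiQT.IsSemiquasitriangular R) :
    ∃ (_ : (SemiQT.ActCoact.finNormal R).IsMonoidal)
      (_ : BraidedCategory (SemiQT.FinNormal R)),
      (∀ (M N : SemiQT.FinNormal R) (m : M.obj) (n : N.obj),
        SemiQT.FinNormal.toLin (β_ M N).hom (m ⊗ₜ[k] n) =
          SemiQT.ActCoact.braid R M.obj N.obj m n) ∧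
      ∀ M : SemiQT.FinNormal R,
        ∃ (hD : SemiQT.ActCoact.finNormal R (M.obj.dual hR.bijective_antipode))
          (P : ExactPairing M (⟨M.obj.dual hR.bijective_antipode, hD⟩ : SemiQT.FinNormal R)),
          SemiQT.FinNormal.toLin P.evaluation' = contractLeft k M.obj ∧
          SemiQT.FinNormal.toLin P.coevaluation' = coevaluation k M.obj :=
  haveI := SemiQT.isMonoidal_finNormal hR
  ⟨this, SemiQT.braidedCategory hR, fun _ _ _ _ => rfl,
    fun M => ⟨(SemiQT.finDual hR M).property, SemiQT.exactPairing hR M, rfl, rfl⟩⟩
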